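/- Call a multiplicative function $f:\mathbb N\to\mathbb C$ with $F(s)=\sum_{n\ge 1} f(n)n^{-s}$ a member of the class $\mathcal C$ if the coefficients $\Lambda_f(n)$ of the Dirichlet series $-F'(s)/F(s)=\sum_{n\ge 2}\Lambda_f(n)n^{-s}$ (that is, $\Lambda_f=(f\log)*g$, where $g$ is the Dirichlet-convolution inverse of $f$) satisfy $|\Lambda_f(n)|\le\Lambda(n)$ for all $n\ge 1$, where $\Lambda$ is the von Mangoldt function. For a Dirichlet character $\chi$ put $S_f(x,\chi)=\sum_{n\le x} f(n)\overline{\chi}(n)$. For a finite set $\Xi$ of primitive Dirichlet characters, let $\Xi_q$ be the set of characters mod $q$ induced by the characters in $\Xi$, and for $(a,q)=1$ let $$\Delta_\Xi(f,x;q,a)=\sum_{\substack{n\le x\\ n\equiv a\ (\mathrm{mod}\ q)}} f(n)-\frac1{\varphi(q)}\sum_{\chi\in\Xi_q}\chi(a)S_f(x,\chi).$$ An integer $n\ge 1$ is $y$-smooth if all of its prime factors are at most $y$. **Theorem.** Fix real numbers $A\ge 0$, $B>A+5$ and $\gamma>2A+6$. There is a constant $C$, depending only on $A$, $B$ and $\gamma$,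 such that the following holds. Let $x\ge 2$ be real, let $Q=x^{1/2}/(\log x)^B$ and $y=x/(\log x)^\gamma$, and let $\mathcal A$ be the set of all primitive characters of conductor at most $(\log x)^B$. If $f\in\mathcal C$ is supported only on $y$-smooth integers, then $$\sum_{q\le Q}\ \max_{(a,q)=1}\bigl|\Delta_{\mathcal A}(f,x;q,a)\bigr|\le C\,\frac{x}{(\log x)^A}.$$ -/

import Mathlib

noncomputable section

namespace BVMult

/-- The arithmetic function `n ↦ f(n) log n`; its Dirichlet series is `-F'(s)`, where
`F(s) = ∑ f(n) n^{-s}`. -/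
def mulLog (f : ArithmeticFunction ℂ) : ArithmeticFunction ℂ :=
  ⟨fun n => f n * (Real.log n : ℂ), by simp⟩

/-- The convolution inverse `g` of a multiplicative function `f`, i.e. `F(s) G(s) = 1`. -/
def convInv (f : ArithmeticFunction ℂ) (hf : f.IsMultiplicative) : ArithmeticFunction ℂ :=
  ArithmeticFunction.dirichletInverse f (invertibleOne.copy (f 1) hf.map_one)

/-- `Λ_f`, the sequence of coefficients of the Dirichlet series `-F'(s)/F(s)`. -/
def vonMangoldtOf (f : ArithmeticFunction ℂ) (hf : f.IsMultiplicative) : ArithmeticFunction ℂ :=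
  mulLog f * convInv f hf

/-- The class `𝒞`: multiplicative `f` with `|Λ_f(n)| ≤ Λ(n)` for all `n ≥ 1`. -/
def ClassC (f : ArithmeticFunction ℂ) : Prop :=
  ∃ hf : f.IsMultiplicative,
    ∀ n : ℕ, 1 ≤ n → ‖vonMangoldtOf f hf n‖ ≤ ArithmeticFunction.vonMangoldt n

/-- `n` is `y`-smooth: all of its prime factors are at most `y`. -/
def IsSmooth (y : ℝ) (n : ℕ) : Prop :=
  ∀ p : ℕ, p.Prime → p ∣ n → (p : ℝ) ≤ y

/-- `f` is supported only on the `y`-smooth (positive) integers. -/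
def SmoothSupported (f : ArithmeticFunction ℂ) (y : ℝ) : Prop :=
  ∀ n : ℕ, f n ≠ 0 → IsSmooth y n

/-- `S_f(x, χ) = ∑_{n ≤ x} f(n) conj(χ(n))`. -/
def charSum (f : ArithmeticFunction ℂ) (x : ℝ) {q : ℕ} (χ : DirichletCharacter ℂ q) : ℂ :=
  ∑ n ∈ Finset.Icc 1 ⌊x⌋₊, f n * (starRingEnd ℂ) (χ (n : ZMod q))

/-- Dirichlet characters of arbitrary modulus; `⟨r, ψ⟩` is the character `ψ` mod `r`. -/
abbrev AnyCharacter : Type := Σ r : ℕ, DirichletCharacter ℂ r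

/-- `Ξ_q`: the characters mod `q` that are induced by the characters in `Ξ`. -/
def inducedChars (Ξ : Set AnyCharacter) (q : ℕ) : Set (DirichletCharacter ℂ q) :=
  {χ | ∃ ψ ∈ Ξ, ∃ h : ψ.1 ∣ q, χ = DirichletCharacter.changeLevel h ψ.2}

open Classical in
/-- `Δ_Ξ(f, x; q, a)`. -/
def Delta (Ξ : Set AnyCharacter) (f : ArithmeticFunction ℂ) (x : ℝ) (q : ℕ) (a : ZMod q) : ℂ :=
  (∑ n ∈ Finset.Icc 1 ⌊x⌋₊ with ((n : ℕ) : ZMod q) = a, f n)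
    - 1 / (Nat.totient q : ℂ) *
      ∑ χ : DirichletCharacter ℂ q with χ ∈ inducedChars Ξ q, χ a * charSum f x χ

/-- The set of all primitive characters (of modulus `r ≥ 1`) of conductor at most `D`. -/
def primitiveUpTo (D : ℝ) : Set AnyCharacter :=
  {ψ | 0 < ψ.1 ∧ ψ.2.IsPrimitive ∧ (ψ.2.conductor : ℝ) ≤ D}

end BVMult

end

noncomputable section

namespace BVMult

open Finset

/-- The additive character `t ↦ exp (2πit)` of `ℝ`. -/
def expTwoPi (t : ℝ) : ℂ := Complex.exp ((2 * Real.pi * t : ℝ) * Complex.I)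

lemma expTwoPi_add (s t : ℝ) : expTwoPi (s + t) = expTwoPi s * expTwoPi t := by
  rw [expTwoPi, expTwoPi, expTwoPi, ← Complex.exp_add]; push_cast; ring_nf

lemma norm_expTwoPi (t : ℝ) : ‖expTwoPi t‖ = 1 := Complex.norm_exp_ofReal_mul_I _

lemma conj_expTwoPi (t : ℝ) : (starRingEnd ℂ) (expTwoPi t) = expTwoPi (-t) := by
  rw [expTwoPi, expTwoPi, ← Complex.exp_conj, map_mul, Complex.conj_ofReal, Complex.conj_I]
  push_cast; ring_nf

lemma expTwoPi_intCast (k : ℤ) : expTwoPi k = 1 := by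
  rw [expTwoPi, Complex.exp_eq_one_iff]
  exact ⟨k, by push_cast; ring⟩

lemma expTwoPi_natCast_mul (k : ℕ) (t : ℝ) : expTwoPi (k * t) = expTwoPi t ^ k := by
  rw [expTwoPi, expTwoPi, ← Complex.exp_nat_mul]; push_cast; ring_nf

lemma four_mul_abs_le_norm_expTwoPi_sub_one {t : ℝ} (ht : |t| ≤ 1 / 2) :
    4 * |t| ≤ ‖expTwoPi t - 1‖ := by
  rw [expTwoPi, mul_comm _ Complex.I, Complex.norm_exp_I_mul_ofReal_sub_one]
  have h1 : 2 * Real.pi * t / 2 = Real.pi * t := by ring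
  rw [h1, norm_mul, Real.norm_eq_abs, Real.norm_eq_abs]
  have h2 : |Real.pi * t| ≤ Real.pi / 2 := by
    rw [abs_mul, abs_of_pos Real.pi_pos]; nlinarith [Real.pi_pos]
  have h3 := Real.mul_abs_le_abs_sin h2
  rw [abs_mul, abs_of_pos Real.pi_pos] at h3
  have h4 : 2 / Real.pi * (Real.pi * |t|) = 2 * |t| := by
    field_simp
  rw [h4] at h3
  norm_num; linarith

lemma expTwoPi_sub_int (t : ℝ) (k : ℤ) : expTwoPi (t - k) = expTwoPi t := by
  have := expTwoPi_add (t - k) k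
  rw [expTwoPi_intCast, mul_one] at this
  rw [← this]; ring_nf

lemma norm_sum_expTwoPi_le_card (K : ℕ) (t : ℝ) : ‖∑ k ∈ range K, expTwoPi (k * t)‖ ≤ K := by
  refine (norm_sum_le _ _).trans ?_
  simp [norm_expTwoPi]

lemma norm_sum_expTwoPi_le (K : ℕ) {t : ℝ} (ht : |t| ≤ 1 / 2) (h0 : t ≠ 0) :
    ‖∑ k ∈ range K, expTwoPi (k * t)‖ ≤ 1 / (2 * |t|) := by
  have h4 := four_mul_abs_le_norm_expTwoPi_sub_one ht
  have hp : 0 < |t| := abs_pos.mpr h0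
  have hne : expTwoPi t ≠ 1 := by
    intro h; rw [h, sub_self, norm_zero] at h4; linarith
  simp_rw [expTwoPi_natCast_mul]
  rw [geom_sum_eq hne, norm_div, div_le_div_iff₀ (by linarith) (by positivity)]
  have : ‖expTwoPi t ^ K - 1‖ ≤ 2 := by
    refine (norm_sub_le _ _).trans ?_
    rw [norm_pow, norm_expTwoPi]; norm_num
  nlinarith

/-- The representative of `t` modulo `1` in `[-1/2, 1/2]`. -/
def centered (t : ℝ) : ℝ := t - round t

lemma abs_centered_le (t : ℝ) : |centered t| ≤ 1 / 2 := abs_sub_round t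

lemma sum_expTwoPi_centered (K : ℕ) (t : ℝ) :
    ∑ k ∈ range K, expTwoPi (k * t) = ∑ k ∈ range K, expTwoPi (k * centered t) := by
  refine sum_congr rfl fun k _ => ?_
  rw [centered, mul_sub]
  have := expTwoPi_sub_int (k * t) (k * round t)
  push_cast at this
  rw [this]

/-- The kernel bound, in terms of the position of `t` modulo `1` on the scale `δ`. -/
lemma norm_sum_mul_norm_sum_le {K : ℕ} {δ : ℝ} (hδ : 0 < δ) (hK : 1 / δ ≤ K) (t : ℝ) :
    ‖∑ k ∈ range (2 * K), expTwoPi (k * t)‖ * ‖∑ k ∈ range K, expTwoPi (k * t)‖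
      ≤ 4 * (K : ℝ) ^ 2 * (1 / (1 + (⌊centered t / δ⌋ : ℝ) ^ 2)) := by
  set z := ⌊centered t / δ⌋ with hz
  have hKδ : 1 ≤ K * δ := by rwa [div_le_iff₀ hδ] at hK
  have hK0 : (0 : ℝ) ≤ K := Nat.cast_nonneg _
  rw [mul_one_div, le_div_iff₀ (by positivity)]
  by_cases h01 : z = 0 ∨ z = -1
  · have h1 := norm_sum_expTwoPi_le_card (2 * K) t
    have h2 := norm_sum_expTwoPi_le_card K t
    have h3 : 1 + (z : ℝ) ^ 2 ≤ 2 := by rcases h01 with h | h <;> rw [h] <;> norm_num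
    push_cast at h1
    calc _ ≤ (2 * K * K : ℝ) * 2 := by gcongr
      _ = _ := by ring
  · push Not at h01
    have hzle : (z : ℝ) * δ ≤ centered t := by
      rw [← le_div_iff₀ hδ]; exact Int.floor_le _
    have hzlt : centered t < (z + 1) * δ := by
      rw [← div_lt_iff₀ hδ]; exact Int.lt_floor_add_one _
    have key : (|(z : ℝ)| / 2) * δ ≤ |centered t| := by
      rcases le_or_gt 1 z with h | h
      · have h' : (1 : ℝ) ≤ z := by exact_mod_cast h
        rw [abs_of_nonneg (by linarith)]
        exact le_trans (by nlinarith) (le_abs_self _)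
      · have h2 : z ≤ -2 := by omega
        have h' : (z : ℝ) ≤ -2 := by exact_mod_cast h2
        rw [abs_of_nonpos (by linarith)]
        exact le_trans (by nlinarith) (neg_le_abs _)
    have hz1 : (1 : ℝ) ≤ (z : ℝ) ^ 2 := by
      have : (1 : ℤ) ≤ z ^ 2 := by nlinarith [sq_nonneg (z : ℤ), Int.one_le_abs h01.1, sq_abs z]
      exact_mod_cast this
    have hzpos : 0 < |(z : ℝ)| := by
      rw [abs_pos]; exact_mod_cast h01.1
    have hcpos : 0 < |centered t| := lt_of_lt_of_le (by positivity) key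
    have hb : ∀ k : ℕ, ‖∑ k ∈ range k, expTwoPi (k * t)‖ ≤ K / |(z : ℝ)| := by
      intro k
      rw [sum_expTwoPi_centered]
      refine (norm_sum_expTwoPi_le k (abs_centered_le t) (abs_pos.mp hcpos)).trans ?_
      rw [div_le_div_iff₀ (by positivity) hzpos]
      nlinarith
    calc _ ≤ (K / |(z : ℝ)| * (K / |(z : ℝ)|)) * (1 + (z : ℝ) ^ 2) := by
          gcongr <;> exact hb _
      _ = K ^ 2 * ((1 + (z : ℝ) ^ 2) / (z : ℝ) ^ 2) := by
          rw [← sq_abs (z : ℝ)]; field_simp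
      _ ≤ K ^ 2 * 4 := by
          gcongr
          rw [div_le_iff₀ (by positivity)]; linarith
      _ = _ := by ring

lemma summable_one_div_one_add_int_sq : Summable fun k : ℤ => 1 / (1 + (k : ℝ) ^ 2) := by
  have h : Summable fun k : ℤ => 1 / (k : ℝ) ^ 2 := Real.summable_one_div_int_pow.mpr one_lt_two
  have h0 : Summable fun k : ℤ => (if k = 0 then (1 : ℝ) else 0) :=
    summable_of_hasFiniteSupport ((Set.finite_singleton (0 : ℤ)).subset fun k hk => by
      by_contra h; simp_all)
  refine Summable.of_nonneg_of_le (fun k => by positivity) (fun k => ?_) (h.add h0)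
  split_ifs with hk
  · simp [hk]
  · rw [add_zero]
    have : 0 < (k : ℝ) ^ 2 := by positivity
    exact one_div_le_one_div_of_le this (by linarith)

/-- `δ`-separation modulo `1` of the points `α i`, `i ∈ s`. -/
def Separated {ι : Type*} (s : Finset ι) (α : ι → ℝ) (δ : ℝ) : Prop :=
  ∀ i ∈ s, ∀ j ∈ s, i ≠ j → ∀ k : ℤ, δ ≤ |α i - α j - k|

lemma Separated.sum_kernel_le {ι : Type*} {s : Finset ι} {α : ι → ℝ} {δ : ℝ} (hδ : 0 < δ)
    (h : Separated s α δ) (θ : ℝ) :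
    ∑ j ∈ s, 1 / (1 + (⌊centered (θ - α j) / δ⌋ : ℝ) ^ 2)
      ≤ ∑' k : ℤ, 1 / (1 + (k : ℝ) ^ 2) := by
  have hinj : Set.InjOn (fun j => ⌊centered (θ - α j) / δ⌋) s := by
    intro i hi j hj hij
    by_contra hne
    have h1 := Int.abs_sub_lt_one_of_floor_eq_floor hij
    rw [← sub_div, abs_div, abs_of_pos hδ, div_lt_one hδ] at h1
    have h2 := h j hj i hi (Ne.symm hne) (round (θ - α i) - round (θ - α j))
    have h3 : centered (θ - α i) - centered (θ - α j)
        = α j - α i - ((round (θ - α i) - round (θ - α j) : ℤ) : ℝ) := by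
      simp only [centered]; push_cast; ring
    rw [h3] at h1
    linarith
  classical
  rw [← sum_image (f := fun k : ℤ => 1 / (1 + (k : ℝ) ^ 2)) hinj]
  exact summable_one_div_one_add_int_sq.sum_le_tsum _ fun k _ => by positivity

lemma norm_sq_sum_mul_expTwoPi {ι : Type*} (s : Finset ι) (α : ι → ℝ) (c : ι → ℂ) (t : ℝ) :
    ((‖∑ i ∈ s, c i * expTwoPi (t * α i)‖ ^ 2 : ℝ) : ℂ) =
      ∑ i ∈ s, ∑ j ∈ s, c i * (starRingEnd ℂ) (c j) * expTwoPi (t * (α i - α j)) := by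
  rw [Complex.ofReal_pow, ← Complex.mul_conj', map_sum, sum_mul_sum]
  refine sum_congr rfl fun i _ => sum_congr rfl fun j _ => ?_
  rw [map_mul, conj_expTwoPi, mul_sub, sub_eq_add_neg, expTwoPi_add]
  ring

/-- The dual form of the additive large sieve. -/
theorem exists_dual_large_sieve : ∃ C : ℝ, 0 < C ∧ ∀ {ι : Type} (s : Finset ι) (α : ι → ℝ)
    (δ : ℝ), 0 < δ → δ ≤ 1 → Separated s α δ → ∀ (N : ℕ) (c : ι → ℂ),
    ∑ n ∈ range N, ‖∑ i ∈ s, c i * expTwoPi (n * α i)‖ ^ 2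
      ≤ C * (N + 1 / δ) * ∑ i ∈ s, ‖c i‖ ^ 2 := by
  set S := ∑' k : ℤ, 1 / (1 + (k : ℝ) ^ 2) with hS
  have hS0 : 0 ≤ S := tsum_nonneg fun k => by positivity
  refine ⟨8 * S + 1, by positivity, fun {ι} s α δ hδ hδ1 hsep N c => ?_⟩
  have hδ1' : 1 ≤ 1 / δ := by rwa [le_div_iff₀ hδ, one_mul]
  set K : ℕ := N + ⌈1 / δ⌉₊ with hK
  have hKδ : 1 / δ ≤ K := (Nat.le_ceil _).trans (by
    rw [hK]; push_cast; linarith [N.cast_nonneg (α := ℝ)])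
  have hKle : (K : ℝ) ≤ 2 * (N + 1 / δ) := by
    have := (Nat.ceil_lt_add_one (by positivity : 0 ≤ 1 / δ)).le
    rw [hK]; push_cast; linarith [N.cast_nonneg (α := ℝ)]
  have hKpos : (0 : ℝ) < K := by linarith
  set T : ℝ → ℝ := fun t => ‖∑ i ∈ s, c i * expTwoPi (t * α i)‖ ^ 2 with hT
  have hshift : (K : ℝ) * ∑ n ∈ range N, T n
      ≤ ∑ l ∈ range K, ∑ k ∈ range (2 * K), T ((k : ℝ) - l) := by
    rw [← nsmul_eq_mul, ← card_range K, ← sum_const, card_range]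
    refine sum_le_sum fun l hl => ?_
    rw [mem_range] at hl
    have hinj : Set.InjOn (fun n => n + l) (range N : Set ℕ) := fun a _ b _ h => by simpa using h
    have : ∑ n ∈ range N, T n = ∑ k ∈ (range N).image (fun n => n + l), T ((k : ℝ) - l) := by
      rw [sum_image hinj]
      refine sum_congr rfl fun n _ => ?_
      push_cast; ring_nf
    rw [this]
    refine sum_le_sum_of_subset_of_nonneg ?_ fun _ _ _ => by positivity
    intro k hk
    rw [mem_image] at hk
    obtain ⟨n, hn, rfl⟩ := hk
    rw [mem_range] at hn ⊢
    omega
  have hexpand : ((∑ l ∈ range K, ∑ k ∈ range (2 * K), T ((k : ℝ) - l) : ℝ) : ℂ) =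
      ∑ i ∈ s, ∑ j ∈ s, c i * (starRingEnd ℂ) (c j) *
        ((∑ k ∈ range (2 * K), expTwoPi (k * (α i - α j))) *
          (starRingEnd ℂ) (∑ l ∈ range K, expTwoPi (l * (α i - α j)))) := by
    rw [Complex.ofReal_sum]
    simp_rw [Complex.ofReal_sum, hT, norm_sq_sum_mul_expTwoPi]
    have : ∀ l ∈ range K, ∑ k ∈ range (2 * K), ∑ i ∈ s, ∑ j ∈ s,
        c i * (starRingEnd ℂ) (c j) * expTwoPi (((k : ℝ) - l) * (α i - α j)) =
        ∑ i ∈ s, ∑ j ∈ s, ∑ k ∈ range (2 * K),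
          c i * (starRingEnd ℂ) (c j) * expTwoPi (((k : ℝ) - l) * (α i - α j)) := by
      intro l _
      rw [sum_comm]
      exact sum_congr rfl fun i _ => sum_comm
    rw [sum_congr rfl this, sum_comm]
    refine sum_congr rfl fun i _ => ?_
    rw [sum_comm]
    refine sum_congr rfl fun j _ => ?_
    rw [sum_comm, map_sum, sum_mul_sum, mul_sum]
    refine sum_congr rfl fun k _ => ?_
    rw [mul_sum]
    refine sum_congr rfl fun l _ => ?_
    rw [conj_expTwoPi, ← expTwoPi_add]
    ring_nf
  have hbound : ∑ l ∈ range K, ∑ k ∈ range (2 * K), T ((k : ℝ) - l)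
      ≤ (4 * K ^ 2 * S) * ∑ i ∈ s, ‖c i‖ ^ 2 := by
    set w : ι → ι → ℝ := fun i j => ‖∑ k ∈ range (2 * K), expTwoPi (k * (α i - α j))‖ *
      ‖∑ k ∈ range K, expTwoPi (k * (α i - α j))‖ with hw
    have hw0 : ∀ i j, 0 ≤ w i j := fun i j => by positivity
    have hnormneg : ∀ (M : ℕ) (t : ℝ), ‖∑ k ∈ range M, expTwoPi (k * (-t))‖ =
        ‖∑ k ∈ range M, expTwoPi (k * t)‖ := by
      intro M t
      rw [← RCLike.norm_conj, map_sum]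
      simp_rw [conj_expTwoPi, mul_neg, neg_neg]
    have hsymm : ∀ i j, w i j = w j i := by
      intro i j
      simp only [hw]
      rw [← neg_sub (α j) (α i), hnormneg, hnormneg]
    have hrow : ∀ i, ∑ j ∈ s, w i j ≤ 4 * K ^ 2 * S := by
      intro i
      calc _ ≤ ∑ j ∈ s, 4 * (K : ℝ) ^ 2 * (1 / (1 + (⌊centered (α i - α j) / δ⌋ : ℝ) ^ 2)) :=
            sum_le_sum fun j _ => norm_sum_mul_norm_sum_le hδ hKδ _
        _ ≤ _ := by
            rw [← mul_sum]
            exact mul_le_mul_of_nonneg_left (hsep.sum_kernel_le hδ _) (by positivity)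
    have hnn : 0 ≤ ∑ l ∈ range K, ∑ k ∈ range (2 * K), T ((k : ℝ) - l) :=
      sum_nonneg fun _ _ => sum_nonneg fun _ _ => by positivity
    calc ∑ l ∈ range K, ∑ k ∈ range (2 * K), T ((k : ℝ) - l)
        = ‖((∑ l ∈ range K, ∑ k ∈ range (2 * K), T ((k : ℝ) - l) : ℝ) : ℂ)‖ := by
          rw [Complex.norm_real, Real.norm_of_nonneg hnn]
      _ ≤ ∑ i ∈ s, ∑ j ∈ s, ‖c i‖ * ‖c j‖ * w i j := by
          rw [hexpand]
          refine (norm_sum_le _ _).trans (sum_le_sum fun i _ => (norm_sum_le _ _).trans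
            (sum_le_sum fun j _ => ?_))
          rw [norm_mul, norm_mul, norm_mul, RCLike.norm_conj, RCLike.norm_conj]
      _ ≤ ∑ i ∈ s, ∑ j ∈ s, (‖c i‖ ^ 2 / 2 * w i j + ‖c j‖ ^ 2 / 2 * w j i) := by
          refine sum_le_sum fun i _ => sum_le_sum fun j _ => ?_
          rw [← hsymm i j, ← add_mul]
          refine mul_le_mul_of_nonneg_right ?_ (hw0 i j)
          nlinarith [sq_nonneg (‖c i‖ - ‖c j‖)]
      _ = ∑ i ∈ s, ‖c i‖ ^ 2 * ∑ j ∈ s, w i j := by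
          simp_rw [sum_add_distrib]
          rw [sum_comm (f := fun i j => ‖c j‖ ^ 2 / 2 * w j i), ← sum_add_distrib]
          refine sum_congr rfl fun i _ => ?_
          rw [← mul_sum]; ring
      _ ≤ ∑ i ∈ s, ‖c i‖ ^ 2 * (4 * K ^ 2 * S) :=
          sum_le_sum fun i _ => mul_le_mul_of_nonneg_left (hrow i) (by positivity)
      _ = _ := by rw [← sum_mul, mul_comm]
  have hfin : ∑ n ∈ range N, T n ≤ 4 * K * S * ∑ i ∈ s, ‖c i‖ ^ 2 := by
    refine le_of_mul_le_mul_left ((hshift.trans hbound).trans_eq ?_) hKpos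
    ring
  refine hfin.trans (mul_le_mul_of_nonneg_right ?_ (by positivity))
  have : 0 ≤ N + 1 / δ := by positivity
  nlinarith [mul_le_mul_of_nonneg_right hKle hS0]

/-- The additive large sieve inequality, with an unspecified constant. -/
theorem exists_large_sieve : ∃ C : ℝ, 0 < C ∧ ∀ {ι : Type} (s : Finset ι) (α : ι → ℝ)
    (δ : ℝ), 0 < δ → δ ≤ 1 → Separated s α δ → ∀ (N : ℕ) (a : ℕ → ℂ),
    ∑ i ∈ s, ‖∑ n ∈ range N, a n * expTwoPi (n * α i)‖ ^ 2
      ≤ C * (N + 1 / δ) * ∑ n ∈ range N, ‖a n‖ ^ 2 := by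
  obtain ⟨C, hC, hdual⟩ := exists_dual_large_sieve
  refine ⟨C, hC, fun {ι} s α δ hδ hδ1 hsep N a => ?_⟩
  set S : ι → ℂ := fun i => ∑ n ∈ range N, a n * expTwoPi (n * α i) with hS
  set V := ∑ i ∈ s, ‖S i‖ ^ 2 with hV
  have hV0 : 0 ≤ V := by positivity
  have hD := hdual s α δ hδ hδ1 hsep N (fun i => (starRingEnd ℂ) (S i))
  simp only [RCLike.norm_conj] at hD
  have hVeq : (V : ℂ) =
      ∑ n ∈ range N, a n * ∑ i ∈ s, (starRingEnd ℂ) (S i) * expTwoPi (n * α i) := by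
    rw [hV, Complex.ofReal_sum]
    simp_rw [mul_sum]
    rw [sum_comm]
    refine sum_congr rfl fun i _ => ?_
    rw [Complex.ofReal_pow, ← Complex.conj_mul', hS, mul_sum]
    exact sum_congr rfl fun n _ => by ring
  have hVle : V ≤ ∑ n ∈ range N,
      ‖a n‖ * ‖∑ i ∈ s, (starRingEnd ℂ) (S i) * expTwoPi (n * α i)‖ := by
    have : V = ‖(V : ℂ)‖ := by rw [Complex.norm_real, Real.norm_of_nonneg hV0]
    rw [this, hVeq]
    refine (norm_sum_le _ _).trans_eq (sum_congr rfl fun n _ => norm_mul _ _)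
  have hsq : V ^ 2 ≤ (∑ n ∈ range N, ‖a n‖ ^ 2) * (C * (N + 1 / δ) * V) := by
    refine (pow_le_pow_left₀ hV0 hVle 2).trans ((sum_mul_sq_le_sq_mul_sq _ _ _).trans ?_)
    exact mul_le_mul_of_nonneg_left hD (by positivity)
  rcases hV0.eq_or_lt with h0 | hpos
  · rw [← h0]; positivity
  · refine le_of_mul_le_mul_right ?_ hpos
    calc V * V = V ^ 2 := by ring
      _ ≤ _ := hsq
      _ = _ := by ring

lemma conj_dirichletCharacter_apply {r : ℕ} [NeZero r] (χ : DirichletCharacter ℂ r) (a : ZMod r) :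
    (starRingEnd ℂ) (χ a) = χ⁻¹ a := by
  rw [← MulChar.star_eq_inv, MulChar.star_apply, RCLike.star_def]

lemma sum_norm_sq_gaussSum_mulShift {r : ℕ} [NeZero r] (χ : DirichletCharacter ℂ r) :
    ∑ b : ZMod r, ‖gaussSum χ (AddChar.mulShift ZMod.stdAddChar b)‖ ^ 2
      = r * ∑ a : ZMod r, ‖χ a‖ ^ 2 := by
  have h : ((∑ b : ZMod r, ‖gaussSum χ (AddChar.mulShift ZMod.stdAddChar b)‖ ^ 2 : ℝ) : ℂ)
      = ((r * ∑ a : ZMod r, ‖χ a‖ ^ 2 : ℝ) : ℂ) := by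
    rw [Complex.ofReal_sum]
    simp_rw [Complex.ofReal_pow, ← Complex.mul_conj', gaussSum, map_sum, sum_mul_sum]
    rw [sum_comm]
    push_cast
    rw [mul_sum]
    refine sum_congr rfl fun a _ => ?_
    rw [sum_comm]
    have : ∀ a' : ZMod r, ∑ b : ZMod r, χ a * (AddChar.mulShift ZMod.stdAddChar b) a *
        (starRingEnd ℂ) (χ a' * (AddChar.mulShift ZMod.stdAddChar b) a') =
        if a' = a then (r : ℂ) * (χ a * (starRingEnd ℂ) (χ a')) else 0 := by
      intro a'
      have h1 := AddChar.sum_mulShift (a - a') (ZMod.isPrimitive_stdAddChar r)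
      simp only [sub_eq_zero, ZMod.card] at h1
      have h2 : ∀ b : ZMod r, χ a * (AddChar.mulShift ZMod.stdAddChar b) a *
          (starRingEnd ℂ) (χ a' * (AddChar.mulShift ZMod.stdAddChar b) a') =
          χ a * (starRingEnd ℂ) (χ a') * ZMod.stdAddChar (b * (a - a')) := by
        intro b
        rw [map_mul, AddChar.mulShift_apply, AddChar.mulShift_apply, mul_sub,
          sub_eq_add_neg, AddChar.map_add_eq_mul, AddChar.map_neg_eq_conj]
        ring
      simp_rw [h2]
      rw [← mul_sum, h1]
      by_cases h3 : a = a'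
      · simp [h3]; ring
      · simp [h3, Ne.symm h3]
    simp_rw [this]
    rw [sum_ite_eq' univ a]
    simp [Complex.mul_conj']
  exact_mod_cast h

lemma norm_sq_gaussSum_of_isPrimitive {r : ℕ} [NeZero r] {χ : DirichletCharacter ℂ r}
    (hχ : χ.IsPrimitive) : ‖gaussSum χ ZMod.stdAddChar‖ ^ 2 = r := by
  have h := sum_norm_sq_gaussSum_mulShift χ
  simp_rw [gaussSum_mulShift_of_isPrimitive _ hχ, norm_mul, mul_pow] at h
  simp_rw [← conj_dirichletCharacter_apply, RCLike.norm_conj] at h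
  rw [← sum_mul, mul_comm] at h
  refine mul_right_cancel₀ ?_ h
  have : ‖χ 1‖ ^ 2 ≤ ∑ a : ZMod r, ‖χ a‖ ^ 2 :=
    single_le_sum (f := fun a => ‖χ a‖ ^ 2) (fun _ _ => by positivity) (mem_univ 1)
  rw [map_one] at this
  norm_num at this
  linarith

lemma sum_dirichletCharacter_mul {r : ℕ} [NeZero r] (χ : DirichletCharacter ℂ r)
    (g : ZMod r → ℂ) : ∑ a : ZMod r, χ a * g a = ∑ u : (ZMod r)ˣ, χ u * g u := by
  refine (Fintype.sum_of_injective (fun u : (ZMod r)ˣ => (u : ZMod r)) Units.val_injective _ _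
    (fun a ha => ?_) (fun _ => rfl)).symm
  rw [MulChar.map_nonunit, zero_mul]
  rintro ⟨u, rfl⟩
  exact ha ⟨u, rfl⟩

lemma sum_characters_norm_sq {r : ℕ} [NeZero r] (g : ZMod r → ℂ) :
    ∑ χ : DirichletCharacter ℂ r, ‖∑ u : (ZMod r)ˣ, χ u * g u‖ ^ 2
      = r.totient * ∑ u : (ZMod r)ˣ, ‖g u‖ ^ 2 := by
  have h : ((∑ χ : DirichletCharacter ℂ r, ‖∑ u : (ZMod r)ˣ, χ u * g u‖ ^ 2 : ℝ) : ℂ)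
      = ((r.totient * ∑ u : (ZMod r)ˣ, ‖g u‖ ^ 2 : ℝ) : ℂ) := by
    rw [Complex.ofReal_sum]
    simp_rw [Complex.ofReal_pow, ← Complex.conj_mul', map_sum, sum_mul_sum]
    rw [sum_comm]
    push_cast
    rw [mul_sum]
    refine sum_congr rfl fun u _ => ?_
    rw [sum_comm]
    have : ∀ v : (ZMod r)ˣ, ∑ χ : DirichletCharacter ℂ r,
        (starRingEnd ℂ) (χ u * g u) * (χ v * g v) =
        if v = u then (r.totient : ℂ) * ((starRingEnd ℂ) (g u) * g v) else 0 := by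
      intro v
      have h1 := DirichletCharacter.sum_char_inv_mul_char_eq ℂ u.isUnit (v : ZMod r)
      have h2 : ∀ χ : DirichletCharacter ℂ r, (starRingEnd ℂ) (χ u * g u) * (χ v * g v) =
          χ (u : ZMod r)⁻¹ * χ v * ((starRingEnd ℂ) (g u) * g v) := by
        intro χ
        rw [map_mul, conj_dirichletCharacter_apply, MulChar.inv_apply, ZMod.inv_coe_unit,
          Ring.inverse_unit]
        ring
      simp_rw [h2]
      rw [← sum_mul, h1]
      by_cases h3 : v = u
      · simp [h3]
      · rw [if_neg, if_neg h3, zero_mul]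
        exact fun h4 => h3 (Units.val_injective h4.symm)
    simp_rw [this]
    rw [sum_ite_eq' univ u]
    simp [Complex.conj_mul']
  exact_mod_cast h

lemma stdAddChar_natCast_mul {r : ℕ} [NeZero r] (n a : ℕ) :
    ZMod.stdAddChar ((n : ZMod r) * (a : ZMod r)) = expTwoPi (n * (a / r : ℝ)) := by
  have := ZMod.stdAddChar_coe (N := r) (n * a)
  push_cast at this
  rw [this, expTwoPi]
  push_cast
  ring_nf

lemma sum_units_zmod {r : ℕ} [NeZero r] (F : ZMod r → ℝ) :
    ∑ u : (ZMod r)ˣ, F u = ∑ a ∈ range r with r.Coprime a, F (a : ZMod r) := by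
  refine sum_bij (fun u _ => (u : ZMod r).val) (fun u _ => ?_) (fun u _ v _ h => ?_)
    (fun a ha => ?_) (fun u _ => ?_)
  · rw [mem_filter, mem_range]
    exact ⟨ZMod.val_lt _, (ZMod.val_coe_unit_coprime u).symm⟩
  · exact Units.val_injective (ZMod.val_injective r h)
  · rw [mem_filter, mem_range] at ha
    exact ⟨ZMod.unitOfCoprime a ha.2.symm, mem_univ _, by
      rw [ZMod.coe_unitOfCoprime, ZMod.val_cast_of_lt ha.1]⟩
  · rw [ZMod.natCast_zmod_val]

open Classical in
lemma sum_primitive_norm_sq_le {r : ℕ} [NeZero r] (s : Finset ℕ) (c : ℕ → ℂ) :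
    (r : ℝ) * ∑ χ : DirichletCharacter ℂ r with χ.IsPrimitive, ‖∑ n ∈ s, c n * χ (n : ZMod r)‖ ^ 2
      ≤ r.totient * ∑ a ∈ range r with r.Coprime a,
          ‖∑ n ∈ s, c n * expTwoPi (n * (a / r : ℝ))‖ ^ 2 := by
  set g : ZMod r → ℂ := fun a => ∑ n ∈ s, c n * ZMod.stdAddChar ((n : ZMod r) * a) with hg
  have key : ∀ χ : DirichletCharacter ℂ r, χ.IsPrimitive →
      (r : ℝ) * ‖∑ n ∈ s, c n * χ (n : ZMod r)‖ ^ 2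
        = ‖∑ u : (ZMod r)ˣ, χ⁻¹ u * g u‖ ^ 2 := by
    intro χ hχ
    have hχ' : (χ⁻¹).IsPrimitive := by
      rw [DirichletCharacter.isPrimitive_def, DirichletCharacter.conductor_inv]; exact hχ
    rw [← norm_sq_gaussSum_of_isPrimitive hχ', ← mul_pow, ← norm_mul,
      ← sum_dirichletCharacter_mul]
    congr 2
    rw [mul_sum]
    have h1 : ∀ n : ℕ, gaussSum χ⁻¹ ZMod.stdAddChar * (c n * χ (n : ZMod r)) =
        c n * gaussSum χ⁻¹ (AddChar.mulShift ZMod.stdAddChar (n : ZMod r)) := by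
      intro n
      rw [gaussSum_mulShift_of_isPrimitive _ hχ', inv_inv]
      ring
    simp_rw [h1, gaussSum, hg, mul_sum]
    rw [sum_comm]
    refine sum_congr rfl fun a _ => sum_congr rfl fun n _ => ?_
    rw [AddChar.mulShift_apply]
    ring
  calc _ = ∑ χ : DirichletCharacter ℂ r with χ.IsPrimitive,
        ‖∑ u : (ZMod r)ˣ, χ⁻¹ u * g u‖ ^ 2 := by
        rw [mul_sum]
        exact sum_congr rfl fun χ hχ => key χ (mem_filter.mp hχ).2
    _ ≤ ∑ χ : DirichletCharacter ℂ r, ‖∑ u : (ZMod r)ˣ, χ⁻¹ u * g u‖ ^ 2 :=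
        sum_le_sum_of_subset_of_nonneg (filter_subset _ _) fun _ _ _ => by positivity
    _ = ∑ χ : DirichletCharacter ℂ r, ‖∑ u : (ZMod r)ˣ, χ u * g u‖ ^ 2 :=
        Equiv.sum_comp (Equiv.inv (DirichletCharacter ℂ r))
          (fun χ : DirichletCharacter ℂ r => ‖∑ u : (ZMod r)ˣ, χ u * g u‖ ^ 2)
    _ = _ := by
        rw [sum_characters_norm_sq, sum_units_zmod (fun a => ‖g a‖ ^ 2)]
        simp_rw [hg, stdAddChar_natCast_mul]

lemma farey_separated (R : ℕ) (hR : 1 ≤ R) :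
    Separated ((Icc 1 R).sigma fun r => (range r).filter (r.Coprime ·))
      (fun i : Σ _ : ℕ, ℕ => (i.2 / i.1 : ℝ)) (1 / (R : ℝ) ^ 2) := by
  rintro ⟨r, a⟩ hi ⟨q, b⟩ hj hne k
  simp only [mem_sigma, mem_Icc, mem_filter, mem_range] at hi hj
  obtain ⟨⟨hr1, hrR⟩, har, hra⟩ := hi
  obtain ⟨⟨hq1, hqR⟩, hbq, hqb⟩ := hj
  dsimp only
  have hr0 : (0 : ℝ) < r := by exact_mod_cast hr1
  have hq0 : (0 : ℝ) < q := by exact_mod_cast hq1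
  have hR0 : (0 : ℝ) < R := by exact_mod_cast hR
  set m : ℤ := a * q - b * r - k * (r * q) with hm
  have heq : (a / r - b / q - k : ℝ) = m / (r * q) := by
    rw [hm]; push_cast; field_simp
  rw [heq, abs_div, abs_of_pos (by positivity : (0 : ℝ) < r * q)]
  have hm0 : m ≠ 0 := by
    intro h0
    apply hne
    have h1 : (a / r - b / q : ℝ) = k := by
      rw [h0] at heq; simp at heq; linarith
    have ha1 : (a / r : ℝ) < 1 := by rw [div_lt_one hr0]; exact_mod_cast har
    have hb1 : (b / q : ℝ) < 1 := by rw [div_lt_one hq0]; exact_mod_cast hbq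
    have ha0 : (0 : ℝ) ≤ a / r := by positivity
    have hb0 : (0 : ℝ) ≤ b / q := by positivity
    have hk1 : k < 1 := by
      have : (k : ℝ) < 1 := by linarith
      exact_mod_cast this
    have hk2 : -1 < k := by
      have : (-1 : ℝ) < k := by linarith
      exact_mod_cast this
    have hk : k = 0 := by omega
    have h2 : a * q = b * r := by
      have : (a * q - b * r : ℤ) = 0 := by rw [hm, hk] at h0; linarith
      have h3 : (a * q : ℤ) = b * r := by linarith
      exact_mod_cast h3
    have hrq : r ∣ q := hra.dvd_of_dvd_mul_left ⟨b, by rw [h2]; ring⟩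
    have hqr : q ∣ r := hqb.dvd_of_dvd_mul_left ⟨a, by rw [← h2]; ring⟩
    have hrq' := Nat.dvd_antisymm hrq hqr
    subst hrq'
    have hab : a = b := Nat.eq_of_mul_eq_mul_right hr1 h2
    rw [hab]
  have hm1 : (1 : ℝ) ≤ |(m : ℝ)| := by
    have := Int.one_le_abs hm0
    exact_mod_cast this
  rw [div_le_div_iff₀ (by positivity) (by positivity)]
  have : (r * q : ℝ) ≤ R ^ 2 := by
    rw [sq]; gcongr
  nlinarith [mul_le_mul hm1 this (by positivity) (by positivity)]

open Classical in
/-- The multiplicative large sieve inequality, with an unspecified constant. -/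
theorem exists_multiplicative_large_sieve : ∃ C : ℝ, 0 < C ∧ ∀ (R N : ℕ) (c : ℕ → ℂ),
    ∑ r ∈ Icc 1 R, (r / r.totient : ℝ) * ∑ χ : DirichletCharacter ℂ r with χ.IsPrimitive,
        ‖∑ n ∈ Icc 1 N, c n * χ (n : ZMod r)‖ ^ 2
      ≤ C * (N + (R : ℝ) ^ 2) * ∑ n ∈ Icc 1 N, ‖c n‖ ^ 2 := by
  obtain ⟨C, hC, hLS⟩ := exists_large_sieve
  refine ⟨2 * C, by positivity, fun R N c => ?_⟩
  rcases Nat.eq_zero_or_pos R with rfl | hR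
  · simp only [Icc_eq_empty_of_lt zero_lt_one, sum_empty]; positivity
  have hR1 : (1 : ℝ) ≤ (R : ℝ) ^ 2 := by
    have : (1 : ℝ) ≤ R := by exact_mod_cast hR
    nlinarith
  set c' : ℕ → ℂ := fun n => if n = 0 then 0 else c n with hc'
  have hIcc : Icc 1 N ⊆ range (N + 1) := by
    intro n hn; rw [mem_Icc] at hn; rw [mem_range]; omega
  have hnot : ∀ n ∈ range (N + 1), n ∉ Icc 1 N → n = 0 := by
    intro n hn hn'; rw [mem_range] at hn; rw [mem_Icc] at hn'; omega
  have hne : ∀ n ∈ Icc 1 N, n ≠ 0 := by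
    intro n hn; rw [mem_Icc] at hn; omega
  have hsum : ∀ t : ℝ, ∑ n ∈ range (N + 1), c' n * expTwoPi (n * t)
      = ∑ n ∈ Icc 1 N, c n * expTwoPi (n * t) := by
    intro t
    rw [← sum_subset hIcc fun n hn hn' => by simp [hc', hnot n hn hn']]
    exact sum_congr rfl fun n hn => by simp [hc', hne n hn]
  have hsum2 : ∑ n ∈ range (N + 1), ‖c' n‖ ^ 2 = ∑ n ∈ Icc 1 N, ‖c n‖ ^ 2 := by
    rw [← sum_subset hIcc fun n hn hn' => by simp [hc', hnot n hn hn']]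
    exact sum_congr rfl fun n hn => by simp [hc', hne n hn]
  have h := hLS _ _ _ (by positivity) (by rw [div_le_one (by positivity)]; exact hR1)
    (farey_separated R hR) (N + 1) c'
  rw [sum_sigma, hsum2, one_div_one_div] at h
  simp_rw [hsum] at h
  calc _ ≤ ∑ r ∈ Icc 1 R, ∑ a ∈ range r with r.Coprime a,
        ‖∑ n ∈ Icc 1 N, c n * expTwoPi (n * (a / r : ℝ))‖ ^ 2 := by
        refine sum_le_sum fun r hr => ?_
        rw [mem_Icc] at hr
        have : NeZero r := ⟨by omega⟩
        have hφ : (0 : ℝ) < r.totient := by exact_mod_cast Nat.totient_pos.mpr (by omega)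
        rw [div_mul_eq_mul_div, div_le_iff₀ hφ, mul_comm _ (r.totient : ℝ)]
        exact sum_primitive_norm_sq_le _ _
    _ ≤ _ := h
    _ ≤ _ := by
        refine mul_le_mul_of_nonneg_right ?_ (by positivity)
        push_cast
        nlinarith [N.cast_nonneg (α := ℝ)]

open Classical in
/-- The large sieve for products of two character sums, over a dyadic range of moduli. -/
theorem exists_bilinear_large_sieve : ∃ C : ℝ, 0 < C ∧ ∀ (R M N : ℕ) (a b : ℕ → ℂ), 1 ≤ R →
    ∑ r ∈ Ico R (2 * R), (1 / r.totient : ℝ) * ∑ χ : DirichletCharacter ℂ r with χ.IsPrimitive,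
        ‖∑ n ∈ Icc 1 M, a n * χ (n : ZMod r)‖ * ‖∑ n ∈ Icc 1 N, b n * χ (n : ZMod r)‖
      ≤ C / R * (√((M + (R : ℝ) ^ 2) * (N + (R : ℝ) ^ 2)) *
          √((∑ n ∈ Icc 1 M, ‖a n‖ ^ 2) * ∑ n ∈ Icc 1 N, ‖b n‖ ^ 2)) := by
  obtain ⟨C, hC, hLS⟩ := exists_multiplicative_large_sieve
  refine ⟨4 * C, by positivity, fun R M N a b hR => ?_⟩
  have hR0 : (0 : ℝ) < R := by exact_mod_cast hR
  set w : ℕ → ℝ := fun r => (r / r.totient : ℝ) with hw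
  have hw0 : ∀ r, 0 ≤ w r := fun r => by positivity
  set A : (Σ r : ℕ, DirichletCharacter ℂ r) → ℝ :=
    fun i => ‖∑ n ∈ Icc 1 M, a n * i.2 (n : ZMod i.1)‖ with hA
  set B : (Σ r : ℕ, DirichletCharacter ℂ r) → ℝ :=
    fun i => ‖∑ n ∈ Icc 1 N, b n * i.2 (n : ZMod i.1)‖ with hB
  set I : Finset (Σ r : ℕ, DirichletCharacter ℂ r) :=
    (Ico R (2 * R)).sigma fun r => univ.filter fun χ => χ.IsPrimitive with hI
  have hone : ∀ (K : ℕ) (c : ℕ → ℂ),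
      ∑ i ∈ I, (√(w i.1) * ‖∑ n ∈ Icc 1 K, c n * i.2 (n : ZMod i.1)‖) ^ 2
        ≤ 4 * C * (K + (R : ℝ) ^ 2) * ∑ n ∈ Icc 1 K, ‖c n‖ ^ 2 := by
    intro K c
    rw [hI, sum_sigma]
    calc _ ≤ ∑ r ∈ Icc 1 (2 * R), (r / r.totient : ℝ) *
          ∑ χ : DirichletCharacter ℂ r with χ.IsPrimitive,
            ‖∑ n ∈ Icc 1 K, c n * χ (n : ZMod r)‖ ^ 2 := by
          refine (sum_le_sum_of_subset_of_nonneg (t := Icc 1 (2 * R)) ?_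
            fun _ _ _ => by positivity).trans_eq (sum_congr rfl fun r _ => ?_)
          · intro r hr; rw [mem_Ico] at hr; rw [mem_Icc]; omega
          · rw [mul_sum]
            refine sum_congr rfl fun χ _ => ?_
            rw [mul_pow, Real.sq_sqrt (hw0 r)]
      _ ≤ _ := hLS _ _ _
      _ ≤ _ := by
          refine mul_le_mul_of_nonneg_right ?_ (by positivity)
          push_cast
          nlinarith [K.cast_nonneg (α := ℝ), mul_nonneg hC.le (K.cast_nonneg (α := ℝ))]
  have hCS := Real.sum_mul_le_sqrt_mul_sqrt I (fun i => √(w i.1) * A i) (fun i => √(w i.1) * B i)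
  calc _ ≤ 1 / R * ∑ i ∈ I, (√(w i.1) * A i) * (√(w i.1) * B i) := by
        rw [hI, sum_sigma, mul_sum]
        refine sum_le_sum fun r hr => ?_
        rw [mem_Ico] at hr
        rw [mul_sum, mul_sum]
        refine sum_le_sum fun χ _ => ?_
        have h1 : √(w r) * A ⟨r, χ⟩ * (√(w r) * B ⟨r, χ⟩) = w r * (A ⟨r, χ⟩ * B ⟨r, χ⟩) := by
          rw [mul_mul_mul_comm, Real.mul_self_sqrt (hw0 r)]
        have hr1 : (1 : ℝ) ≤ r / R := by
          rw [le_div_iff₀ hR0, one_mul]; exact_mod_cast hr.1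
        have h2 : (1 / r.totient : ℝ) ≤ 1 / R * w r :=
          calc (1 / r.totient : ℝ) ≤ 1 / r.totient * (r / R) :=
                le_mul_of_one_le_right (by positivity) hr1
            _ = _ := by rw [hw]; ring
        have h3 : 0 ≤ A ⟨r, χ⟩ * B ⟨r, χ⟩ := mul_nonneg (norm_nonneg _) (norm_nonneg _)
        rw [h1]
        exact (mul_le_mul_of_nonneg_right h2 h3).trans_eq (by ring)
    _ ≤ 1 / R * (√(4 * C * (M + (R : ℝ) ^ 2) * ∑ n ∈ Icc 1 M, ‖a n‖ ^ 2) *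
          √(4 * C * (N + (R : ℝ) ^ 2) * ∑ n ∈ Icc 1 N, ‖b n‖ ^ 2)) := by
        refine mul_le_mul_of_nonneg_left (hCS.trans ?_) (by positivity)
        gcongr
        · exact hone M a
        · exact hone N b
    _ = _ := by
        rw [← Real.sqrt_mul (by positivity), ← Real.sqrt_mul (by positivity)]
        have : 4 * C * (M + (R : ℝ) ^ 2) * (∑ n ∈ Icc 1 M, ‖a n‖ ^ 2) *
            (4 * C * (N + (R : ℝ) ^ 2) * ∑ n ∈ Icc 1 N, ‖b n‖ ^ 2) =
            (4 * C) ^ 2 * ((M + (R : ℝ) ^ 2) * (N + (R : ℝ) ^ 2) *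
              ((∑ n ∈ Icc 1 M, ‖a n‖ ^ 2) * ∑ n ∈ Icc 1 N, ‖b n‖ ^ 2)) := by ring
        rw [this, Real.sqrt_mul (by positivity), Real.sqrt_sq (by positivity)]
        ring

open Classical in
/-- The first moment of primitive character sums, over a dyadic range of moduli. -/
theorem exists_sum_primitive_norm_le : ∃ C : ℝ, 0 < C ∧ ∀ (R N : ℕ) (a : ℕ → ℂ), 1 ≤ R →
    ∑ r ∈ Ico R (2 * R), (1 / r.totient : ℝ) * ∑ χ : DirichletCharacter ℂ r with χ.IsPrimitive,
        ‖∑ n ∈ Icc 1 N, a n * χ (n : ZMod r)‖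
      ≤ C * √((N + (R : ℝ) ^ 2) * ∑ n ∈ Icc 1 N, ‖a n‖ ^ 2) := by
  obtain ⟨C, hC, h⟩ := exists_bilinear_large_sieve
  refine ⟨2 * C, by positivity, fun R N a hR => ?_⟩
  have hR1 : (1 : ℝ) ≤ R := by exact_mod_cast hR
  have h1 := h R N 1 a (fun _ => 1) hR
  simp only [Icc_self, sum_singleton, Nat.cast_one, map_one, mul_one, norm_one, one_pow] at h1
  refine h1.trans ?_
  rw [← Real.sqrt_mul (by positivity), div_mul_eq_mul_div, div_le_iff₀ (by positivity)]
  have : √((N + (R : ℝ) ^ 2) * (1 + (R : ℝ) ^ 2) * ∑ n ∈ Icc 1 N, ‖a n‖ ^ 2)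
      ≤ (2 * R) * √((N + (R : ℝ) ^ 2) * ∑ n ∈ Icc 1 N, ‖a n‖ ^ 2) := by
    rw [← Real.sqrt_sq (by positivity : (0 : ℝ) ≤ 2 * R), ← Real.sqrt_mul (by positivity)]
    refine Real.sqrt_le_sqrt ?_
    have h2 : 0 ≤ (N + (R : ℝ) ^ 2) * ∑ n ∈ Icc 1 N, ‖a n‖ ^ 2 := by positivity
    nlinarith [mul_le_mul_of_nonneg_right
      (by nlinarith : 1 + (R : ℝ) ^ 2 ≤ (2 * R) ^ 2) h2]
  nlinarith

/-- The coefficients of the discrete Fourier expansion of the indicator of `[1, K]` in `[1, N]`. -/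
def cutoffCoeff (N h K : ℕ) : ℂ := 1 / N * ∑ k ∈ Icc 1 K, expTwoPi (-(h * k / N : ℝ))

/-- An upper bound for `‖cutoffCoeff N h K‖` that is uniform in `K`. -/
def cutoffBound (N h : ℕ) : ℝ := if h = 0 then 1 else 1 / h + 1 / (N - h : ℕ)

lemma sum_expTwoPi_div {N m k : ℕ} (hm : m ∈ Icc 1 N) (hk : k ∈ Icc 1 N) :
    ∑ h ∈ range N, expTwoPi (h * (((m : ℝ) - k) / N)) = if m = k then (N : ℂ) else 0 := by
  rw [mem_Icc] at hm hk
  have hN : (0 : ℝ) < N := by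
    have : 0 < N := by omega
    exact_mod_cast this
  have h0 : expTwoPi 0 = 1 := by simpa using expTwoPi_intCast 0
  split_ifs with h
  · simp [h, h0]
  · simp_rw [expTwoPi_natCast_mul]
    have hne : expTwoPi (((m : ℝ) - k) / N) ≠ 1 := by
      intro h1
      rw [expTwoPi, Complex.exp_eq_one_iff] at h1
      obtain ⟨n, hn⟩ := h1
      have h2 : ((2 * Real.pi * (((m : ℝ) - k) / N) : ℝ) : ℂ) * Complex.I =
          ((2 * Real.pi * n : ℝ) : ℂ) * Complex.I := by
        rw [hn]; push_cast; ring
      have h3 := mul_right_cancel₀ Complex.I_ne_zero h2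
      rw [Complex.ofReal_inj] at h3
      have h4 := mul_left_cancel₀ (by positivity) h3
      rw [div_eq_iff hN.ne'] at h4
      have h5 : (m : ℤ) - k = n * N := by exact_mod_cast h4
      have h6 : n = 0 := by
        by_contra h0
        have := Int.one_le_abs h0
        have h7 : |(m : ℤ) - k| = |n| * N := by rw [h5, abs_mul, Nat.abs_cast]
        have h8 : |(m : ℤ) - k| < N := by rw [abs_lt]; omega
        nlinarith
      rw [h6] at h5
      omega
    rw [geom_sum_eq hne, ← expTwoPi_natCast_mul, mul_div_cancel₀ _ hN.ne']
    have : expTwoPi ((m : ℝ) - k) = 1 := by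
      have := expTwoPi_intCast ((m : ℤ) - k)
      push_cast at this
      exact this
    rw [this, sub_self, zero_div]

lemma sum_cutoffCoeff {N m K : ℕ} (hm : m ∈ Icc 1 N) (hK : K ≤ N) :
    ∑ h ∈ range N, cutoffCoeff N h K * expTwoPi (h * m / N) = if m ≤ K then 1 else 0 := by
  have hN : (N : ℂ) ≠ 0 := by
    rw [mem_Icc] at hm
    have : N ≠ 0 := by omega
    exact_mod_cast this
  have h1 : ∀ h : ℕ, cutoffCoeff N h K * expTwoPi (h * m / N) =
      1 / N * ∑ k ∈ Icc 1 K, expTwoPi (h * (((m : ℝ) - k) / N)) := by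
    intro h
    rw [cutoffCoeff, mul_assoc, sum_mul]
    congr 1
    refine sum_congr rfl fun k _ => ?_
    rw [← expTwoPi_add]
    ring_nf
  simp_rw [h1]
  rw [← mul_sum, sum_comm]
  have h2 : ∀ k ∈ Icc 1 K, ∑ h ∈ range N, expTwoPi (h * (((m : ℝ) - k) / N)) =
      if m = k then (N : ℂ) else 0 := by
    intro k hk
    refine sum_expTwoPi_div hm ?_
    rw [mem_Icc] at hk ⊢
    omega
  rw [sum_congr rfl h2, sum_ite_eq]
  rw [mem_Icc] at hm
  by_cases h : m ≤ K
  · simp [h, hm.1, hN]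
  · simp [h]

lemma norm_cutoffCoeff_le {N h K : ℕ} (hh : h < N) (hK : K ≤ N) :
    ‖cutoffCoeff N h K‖ ≤ cutoffBound N h := by
  have hN : (0 : ℝ) < N := by
    have : 0 < N := by omega
    exact_mod_cast this
  rw [cutoffCoeff, cutoffBound, norm_mul, norm_div, norm_one, Complex.norm_natCast,
    one_div_mul_eq_div, div_le_iff₀ hN]
  split_ifs with h0
  · refine (norm_sum_le _ _).trans ?_
    simp only [norm_expTwoPi, sum_const, Nat.card_Icc, nsmul_eq_mul, mul_one, one_mul]
    simpa using hK
  · have hshift : ∀ t : ℝ, (∃ n : ℤ, t = -(h / N : ℝ) + n) →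
        ‖∑ k ∈ Icc 1 K, expTwoPi (-(h * k / N : ℝ))‖ = ‖∑ k ∈ range K, expTwoPi (k * t)‖ := by
      rintro t ⟨n, rfl⟩
      have h1 : ∀ k : ℕ, expTwoPi (-(h * k / N : ℝ)) = expTwoPi (k * (-(h / N : ℝ) + n)) := by
        intro k
        have := expTwoPi_sub_int (k * (-(h / N : ℝ) + n)) (k * n)
        rw [← this]; push_cast; ring_nf
      simp_rw [h1]
      have h2 : ∑ k ∈ Icc 1 K, expTwoPi (k * (-(h / N : ℝ) + n)) =
          expTwoPi (-(h / N : ℝ) + n) * ∑ k ∈ range K, expTwoPi (k * (-(h / N : ℝ) + n)) := by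
        rw [mul_sum, range_eq_Ico]
        have : Icc 1 K = Ico (0 + 1) (K + 1) := by ext; simp
        rw [this, ← sum_Ico_add' (fun k : ℕ => expTwoPi (k * (-(h / N : ℝ) + n)))]
        refine sum_congr rfl fun k _ => ?_
        rw [← expTwoPi_add]; push_cast; ring_nf
      rw [h2, norm_mul, norm_expTwoPi, one_mul]
    have hh0 : (0 : ℝ) < h := by exact_mod_cast Nat.pos_of_ne_zero h0
    have hNh : (0 : ℝ) < (N - h : ℕ) := by
      have : 0 < N - h := by omega
      exact_mod_cast this
    rcases le_or_gt (2 * h) N with hle | hgt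
    · have hle' : (2 * h : ℝ) ≤ N := by exact_mod_cast hle
      have habs : |(-(h / N : ℝ))| = h / N := by
        rw [abs_neg, abs_of_pos (by positivity)]
      rw [hshift (-(h / N : ℝ)) ⟨0, by simp⟩]
      refine (norm_sum_expTwoPi_le K ?_ (by rw [neg_ne_zero]; positivity)).trans ?_
      · rw [habs, div_le_div_iff₀ hN two_pos]; linarith
      · rw [habs]
        calc 1 / (2 * (h / N : ℝ)) = 1 / h * N / 2 := by field_simp
          _ ≤ 1 / h * N := half_le_self (by positivity)
          _ ≤ _ := by gcongr; linarith [one_div_pos.mpr hNh]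
    · have hgt' : (N : ℝ) < 2 * h := by exact_mod_cast hgt
      have hcast : ((N - h : ℕ) : ℝ) = N - h := by rw [Nat.cast_sub hh.le]
      have heq : -(h / N : ℝ) + (1 : ℤ) = (N - h : ℕ) / N := by
        rw [hcast]; field_simp; push_cast; ring
      have habs : |((N - h : ℕ) / N : ℝ)| = (N - h : ℕ) / N := abs_of_pos (by positivity)
      rw [hshift ((N - h : ℕ) / N : ℝ) ⟨1, heq.symm⟩]
      refine (norm_sum_expTwoPi_le K ?_ (by positivity)).trans ?_
      · rw [habs, div_le_div_iff₀ hN two_pos, hcast]; linarith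
      · rw [habs]
        calc 1 / (2 * ((N - h : ℕ) / N : ℝ)) = 1 / (N - h : ℕ) * N / 2 := by field_simp
          _ ≤ 1 / (N - h : ℕ) * N := half_le_self (by positivity)
          _ ≤ _ := by gcongr; linarith [one_div_pos.mpr hh0]

lemma cutoffBound_nonneg (N h : ℕ) : 0 ≤ cutoffBound N h := by
  rw [cutoffBound]; split_ifs <;> positivity

lemma sum_one_div_Icc_le (N : ℕ) : ∑ h ∈ Icc 1 N, (1 / h : ℝ) ≤ 1 + Real.log N := by
  have := harmonic_le_one_add_log N
  rw [harmonic_eq_sum_Icc] at this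
  push_cast at this
  simpa [one_div] using this

lemma sum_cutoffBound_le {N : ℕ} (hN : 1 ≤ N) :
    ∑ h ∈ range N, cutoffBound N h ≤ 3 + 2 * Real.log N := by
  obtain ⟨n, rfl⟩ : ∃ n, N = n + 1 := ⟨N - 1, by omega⟩
  rw [sum_range_succ']
  have h0 : cutoffBound (n + 1) 0 = 1 := by simp [cutoffBound]
  have h1 : ∀ h ∈ range n, cutoffBound (n + 1) (h + 1) =
      1 / ((h + 1 : ℕ) : ℝ) + 1 / ((n - 1 - h + 1 : ℕ) : ℝ) := by
    intro h hh
    rw [mem_range] at hh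
    rw [cutoffBound, if_neg (by omega)]
    congr 3
    omega
  rw [h0, sum_congr rfl h1, sum_add_distrib,
    sum_range_reflect (fun h : ℕ => 1 / ((h + 1 : ℕ) : ℝ)) n]
  have h2 : ∑ h ∈ range n, 1 / ((h + 1 : ℕ) : ℝ) ≤ 1 + Real.log (n + 1 : ℕ) := by
    refine le_trans ?_ (sum_one_div_Icc_le (n + 1))
    have : Icc 1 (n + 1) = Ico (0 + 1) (n + 1 + 1) := by ext; simp
    rw [this, ← sum_Ico_add' (fun k : ℕ => 1 / (k : ℝ)), ← range_eq_Ico, sum_range_succ]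
    have : (0 : ℝ) ≤ 1 / ((n + 1 : ℕ) : ℝ) := by positivity
    linarith
  linarith

open Classical in
/-- The large sieve for sums over a hyperbolic region `m * k ≤ X` with `m ∈ [M, 2M)`. -/
theorem exists_sum_hyperbola_le : ∃ C : ℝ, 0 < C ∧ ∀ (R M X : ℕ) (a b : ℕ → ℂ), 1 ≤ R → 1 ≤ M →
    1 ≤ X → (∀ n, ‖a n‖ ≤ 1) → (∀ n, ‖b n‖ ≤ 1) →
    ∑ r ∈ Ico R (2 * R), (1 / r.totient : ℝ) * ∑ χ : DirichletCharacter ℂ r with χ.IsPrimitive,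
        ‖∑ m ∈ Ico M (2 * M), ∑ k ∈ Icc 1 (X / m),
          a m * b k * (χ (m : ZMod r) * χ (k : ZMod r))‖
      ≤ C * (3 + 2 * Real.log X) * (X / R + √X * √M + X / √M + R * √X) := by
  obtain ⟨C, hC, hbil⟩ := exists_bilinear_large_sieve
  refine ⟨2 * C, by positivity, fun R M X a b hR hM hX ha hb => ?_⟩
  have hX1 : (1 : ℝ) ≤ X := by exact_mod_cast hX
  have hR0 : (0 : ℝ) < R := by exact_mod_cast hR
  have hM0 : (0 : ℝ) < M := by exact_mod_cast hM
  have hlogX : 0 ≤ Real.log X := Real.log_nonneg hX1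
  rcases Nat.lt_or_ge X M with hXM | hXM
  · have : ∀ r ∈ Ico R (2 * R), (1 / r.totient : ℝ) *
        ∑ χ : DirichletCharacter ℂ r with χ.IsPrimitive, ‖∑ m ∈ Ico M (2 * M),
          ∑ k ∈ Icc 1 (X / m), a m * b k * (χ (m : ZMod r) * χ (k : ZMod r))‖ = 0 := by
      intro r _
      refine mul_eq_zero_of_right _ (sum_eq_zero fun χ _ => ?_)
      rw [sum_eq_zero, norm_zero]
      intro m hm
      rw [mem_Ico] at hm
      rw [Nat.div_eq_of_lt (by omega), Icc_eq_empty_of_lt zero_lt_one, sum_empty]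
    rw [sum_eq_zero this]
    positivity
  set N := X / M with hN
  have hN1 : 1 ≤ N := Nat.div_pos hXM hM
  have hNX : (N : ℝ) ≤ X := by exact_mod_cast Nat.div_le_self X M
  have hNM : (N : ℝ) ≤ X / M := Nat.cast_div_le
  have hN0 : (0 : ℝ) < N := by exact_mod_cast hN1
  set a' : ℕ → ℕ → ℂ := fun h m => if m ∈ Ico M (2 * M) then a m * cutoffCoeff N h (X / m) else 0
    with ha'
  set b' : ℕ → ℕ → ℂ := fun h k => b k * expTwoPi (h * k / N) with hb'
  have hdiv : ∀ m ∈ Ico M (2 * M), X / m ≤ N := by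
    intro m hm
    rw [mem_Ico] at hm
    exact Nat.div_le_div_left hm.1 hM
  have hIcc : Ico M (2 * M) ⊆ Icc 1 (2 * M) := by
    intro m hm; rw [mem_Ico] at hm; rw [mem_Icc]; omega
  have hsplit : ∀ (r : ℕ) (χ : DirichletCharacter ℂ r),
      ∑ m ∈ Ico M (2 * M), ∑ k ∈ Icc 1 (X / m), a m * b k * (χ (m : ZMod r) * χ (k : ZMod r)) =
      ∑ h ∈ range N, (∑ m ∈ Icc 1 (2 * M), a' h m * χ (m : ZMod r)) *
        ∑ k ∈ Icc 1 N, b' h k * χ (k : ZMod r) := by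
    intro r χ
    have h1 : ∀ h, ∑ m ∈ Icc 1 (2 * M), a' h m * χ (m : ZMod r) =
        ∑ m ∈ Ico M (2 * M), a m * cutoffCoeff N h (X / m) * χ (m : ZMod r) := by
      intro h
      rw [← sum_subset hIcc fun m _ hm => by simp only [ha', if_neg hm, zero_mul]]
      exact sum_congr rfl fun m hm => by simp only [ha', if_pos hm]
    simp_rw [h1, sum_mul_sum]
    rw [sum_comm]
    refine sum_congr rfl fun m hm => ?_
    rw [sum_comm]
    have h2 : Icc 1 (X / m) = (Icc 1 N).filter (· ≤ X / m) := by
      ext k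
      have := hdiv m hm
      simp only [mem_filter, mem_Icc]
      omega
    rw [h2, sum_filter]
    refine sum_congr rfl fun k hk => ?_
    have h3 := sum_cutoffCoeff hk (hdiv m hm)
    have h4 : ∀ h ∈ range N, a m * cutoffCoeff N h (X / m) * χ (m : ZMod r) *
        (b' h k * χ (k : ZMod r)) = a m * b k * (χ (m : ZMod r) * χ (k : ZMod r)) *
          (cutoffCoeff N h (X / m) * expTwoPi (h * k / N)) := by
      intro h _
      simp only [hb']; ring
    rw [sum_congr rfl h4, ← mul_sum, h3]
    simp
  have hnorma : ∀ h ∈ range N, ∑ m ∈ Icc 1 (2 * M), ‖a' h m‖ ^ 2 ≤ M * cutoffBound N h ^ 2 := by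
    intro h hh
    rw [mem_range] at hh
    rw [← sum_subset hIcc fun m _ hm => by simp only [ha', if_neg hm]; simp]
    calc _ ≤ ∑ m ∈ Ico M (2 * M), cutoffBound N h ^ 2 := by
          refine sum_le_sum fun m hm => ?_
          simp only [ha', if_pos hm, norm_mul]
          refine pow_le_pow_left₀ (by positivity) ?_ 2
          calc ‖a m‖ * ‖cutoffCoeff N h (X / m)‖ ≤ 1 * cutoffBound N h :=
                mul_le_mul (ha m) (norm_cutoffCoeff_le hh (hdiv m hm)) (norm_nonneg _) zero_le_one
            _ = _ := one_mul _
      _ = _ := by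
          rw [sum_const, Nat.card_Ico, nsmul_eq_mul, two_mul, Nat.add_sub_cancel]
  have hnormb : ∀ h, ∑ k ∈ Icc 1 N, ‖b' h k‖ ^ 2 ≤ N := by
    intro h
    calc _ ≤ ∑ k ∈ Icc 1 N, (1 : ℝ) := by
          refine sum_le_sum fun k _ => ?_
          simp only [hb', norm_mul, norm_expTwoPi, mul_one]
          exact pow_le_one₀ (norm_nonneg _) (hb k)
      _ = _ := by simp
  set E : ℝ := √((((2 * M : ℕ) : ℝ) + (R : ℝ) ^ 2) * (N + (R : ℝ) ^ 2)) with hE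
  have hEbound : E * √(M * N : ℝ) ≤ 2 * (R * (X / R + √X * √M + X / √M + R * √X)) := by
    have hMN : (M : ℝ) * N ≤ X := by rwa [le_div_iff₀ hM0, mul_comm] at hNM
    have hsX := Real.sq_sqrt (by positivity : (0 : ℝ) ≤ X)
    have hsM := Real.sq_sqrt hM0.le
    have hsM0 := Real.sqrt_pos.mpr hM0
    have h1 : E ≤ 2 * (√X + R * √M + R * (√X / √M) + R ^ 2) := by
      rw [hE]
      refine Real.sqrt_le_iff.mpr ⟨by positivity, ?_⟩
      calc (((2 * M : ℕ) : ℝ) + (R : ℝ) ^ 2) * (N + (R : ℝ) ^ 2)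
          ≤ (2 * M + (R : ℝ) ^ 2) * (X / M + (R : ℝ) ^ 2) := by
            push_cast; gcongr
        _ ≤ 4 * ((X : ℝ) + (R : ℝ) ^ 2 * M + (R : ℝ) ^ 2 * ((X : ℝ) / M) + ((R : ℝ) ^ 2) ^ 2) := by
            have : (M : ℝ) * (X / M) = X := by field_simp
            have h2 : (0 : ℝ) ≤ R ^ 2 * (X / M) := by positivity
            have h3 : (0 : ℝ) ≤ R ^ 2 * M := by positivity
            have h4 : (0 : ℝ) ≤ (R ^ 2) ^ 2 := by positivity
            nlinarith
        _ = 4 * (√(X : ℝ) ^ 2 + ((R : ℝ) * √(M : ℝ)) ^ 2 + ((R : ℝ) * (√(X : ℝ) / √(M : ℝ))) ^ 2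
            + ((R : ℝ) ^ 2) ^ 2) := by
            rw [mul_pow, mul_pow, div_pow, hsX, hsM]
        _ ≤ _ := by
            have p1 : 0 ≤ √(X : ℝ) := by positivity
            have p2 : 0 ≤ R * √(M : ℝ) := by positivity
            have p3 : 0 ≤ R * (√(X : ℝ) / √M) := by positivity
            have p4 : (0 : ℝ) ≤ R ^ 2 := by positivity
            nlinarith [mul_nonneg p1 p2, mul_nonneg p1 p3, mul_nonneg p1 p4, mul_nonneg p2 p3,
              mul_nonneg p2 p4, mul_nonneg p3 p4]
    calc E * √(M * N : ℝ) ≤ (2 * (√X + R * √M + R * (√X / √M) + R ^ 2)) * √X :=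
          mul_le_mul h1 (Real.sqrt_le_sqrt hMN) (by positivity) (by positivity)
      _ = 2 * (√X ^ 2 + R * (√X * √M) + R * (√X ^ 2 / √M) + R ^ 2 * √X) := by ring
      _ = _ := by rw [hsX]; field_simp
  have hterm : ∀ h ∈ range N, ∑ r ∈ Ico R (2 * R), (1 / r.totient : ℝ) *
      ∑ χ : DirichletCharacter ℂ r with χ.IsPrimitive,
        ‖∑ m ∈ Icc 1 (2 * M), a' h m * χ (m : ZMod r)‖ * ‖∑ k ∈ Icc 1 N, b' h k * χ (k : ZMod r)‖
      ≤ C / R * (E * √(M * N : ℝ)) * cutoffBound N h := by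
    intro h hh
    refine (hbil R (2 * M) N (a' h) (b' h) hR).trans ?_
    have h0 := cutoffBound_nonneg N h
    have : √((∑ n ∈ Icc 1 (2 * M), ‖a' h n‖ ^ 2) * ∑ n ∈ Icc 1 N, ‖b' h n‖ ^ 2)
        ≤ √(M * N : ℝ) * cutoffBound N h := by
      conv_rhs => rw [← Real.sqrt_sq h0, ← Real.sqrt_mul (by positivity)]
      refine Real.sqrt_le_sqrt ?_
      calc _ ≤ (M * cutoffBound N h ^ 2) * N :=
            mul_le_mul (hnorma h hh) (hnormb h) (by positivity) (by positivity)
        _ = _ := by ring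
    calc _ ≤ C / R * (E * (√(M * N : ℝ) * cutoffBound N h)) := by gcongr
      _ = _ := by ring
  calc _ ≤ ∑ r ∈ Ico R (2 * R), (1 / r.totient : ℝ) *
      ∑ χ : DirichletCharacter ℂ r with χ.IsPrimitive, ∑ h ∈ range N,
        ‖∑ m ∈ Icc 1 (2 * M), a' h m * χ (m : ZMod r)‖ *
          ‖∑ k ∈ Icc 1 N, b' h k * χ (k : ZMod r)‖ := by
        refine sum_le_sum fun r _ => mul_le_mul_of_nonneg_left (sum_le_sum fun χ _ => ?_)
          (by positivity)
        rw [hsplit]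
        exact (norm_sum_le _ _).trans_eq (sum_congr rfl fun h _ => norm_mul _ _)
    _ = ∑ h ∈ range N, ∑ r ∈ Ico R (2 * R), (1 / r.totient : ℝ) *
      ∑ χ : DirichletCharacter ℂ r with χ.IsPrimitive,
        ‖∑ m ∈ Icc 1 (2 * M), a' h m * χ (m : ZMod r)‖ *
          ‖∑ k ∈ Icc 1 N, b' h k * χ (k : ZMod r)‖ := by
        rw [sum_comm]
        refine sum_congr rfl fun r _ => ?_
        rw [sum_comm, mul_sum]
    _ ≤ ∑ h ∈ range N, C / R * (E * √(M * N : ℝ)) * cutoffBound N h := sum_le_sum hterm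
    _ = C / R * (E * √(M * N : ℝ)) * ∑ h ∈ range N, cutoffBound N h := by rw [mul_sum]
    _ ≤ C / R * (2 * (R * (X / R + √X * √M + X / √M + R * √X))) * (3 + 2 * Real.log X) := by
        have hl : Real.log N ≤ Real.log X := Real.log_le_log hN0 hNX
        have hc := sum_cutoffBound_le hN1
        refine mul_le_mul (mul_le_mul_of_nonneg_left hEbound (by positivity)) (by linarith)
          (sum_nonneg fun h _ => cutoffBound_nonneg N h) (by positivity)
    _ = _ := by field_simp

lemma vonMangoldtOf_mul_self (f : ArithmeticFunction ℂ) (hf : f.IsMultiplicative) :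
    vonMangoldtOf f hf * f = mulLog f := by
  rw [vonMangoldtOf, mul_assoc, convInv, ArithmeticFunction.dirichletInverse_mul_self, mul_one]

/-- A function in the class `𝒞` is bounded by `1`. -/
lemma ClassC.norm_le_one {f : ArithmeticFunction ℂ} (hf : ClassC f) (n : ℕ) : ‖f n‖ ≤ 1 := by
  obtain ⟨hmul, hΛ⟩ := hf
  induction n using Nat.strong_induction_on with
  | _ n ih =>
    rcases Nat.lt_or_ge n 2 with hn | hn
    · interval_cases n
      · simp
      · simp [hmul.map_one]
    · have hlog : 0 < Real.log n := Real.log_pos (by exact_mod_cast hn)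
      have h1 : f n * (Real.log n : ℂ) =
          ∑ d ∈ n.divisorsAntidiagonal, vonMangoldtOf f hmul d.1 * f d.2 := by
        rw [← ArithmeticFunction.mul_apply, vonMangoldtOf_mul_self]; rfl
      have h2 : ‖f n‖ * Real.log n ≤ ∑ d ∈ n.divisorsAntidiagonal,
          ArithmeticFunction.vonMangoldt d.1 := by
        calc ‖f n‖ * Real.log n = ‖f n * (Real.log n : ℂ)‖ := by
              rw [norm_mul, Complex.norm_real, Real.norm_of_nonneg hlog.le]
          _ ≤ ∑ d ∈ n.divisorsAntidiagonal, ‖vonMangoldtOf f hmul d.1 * f d.2‖ := by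
              rw [h1]; exact norm_sum_le _ _
          _ ≤ _ := by
              refine sum_le_sum fun d hd => ?_
              rw [Nat.mem_divisorsAntidiagonal] at hd
              have hd1 : 1 ≤ d.1 := Nat.pos_of_ne_zero fun h => hd.2 (by rw [← hd.1, h, zero_mul])
              have hd2 : 1 ≤ d.2 := Nat.pos_of_ne_zero fun h => hd.2 (by rw [← hd.1, h, mul_zero])
              rw [norm_mul]
              rcases hd1.eq_or_lt with h | h
              · have := hΛ d.1 hd1
                rw [← h, ArithmeticFunction.vonMangoldt_apply_one] at this ⊢
                rw [le_antisymm this (norm_nonneg _), zero_mul]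
              · have hlt : d.2 < n := by rw [← hd.1]; nlinarith
                calc _ ≤ ArithmeticFunction.vonMangoldt d.1 * 1 :=
                      mul_le_mul (hΛ d.1 hd1) (ih d.2 hlt) (norm_nonneg _)
                        ArithmeticFunction.vonMangoldt_nonneg
                  _ = _ := mul_one _
      rw [Nat.sum_divisorsAntidiagonal (fun i _ => ArithmeticFunction.vonMangoldt i),
        ArithmeticFunction.vonMangoldt_sum] at h2
      exact le_of_mul_le_mul_right (by rwa [one_mul]) hlog

/-- The number of elements of `P` that divide `n`. -/
def countDvd (P : Finset ℕ) (n : ℕ) : ℕ := #{p ∈ P | p ∣ n}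

/-- The main term of Ramaré's identity for `f`, with respect to a set `P` of primes. -/
def ramare (P : Finset ℕ) (f : ℕ → ℂ) (n : ℕ) : ℂ :=
  ∑ p ∈ P with p ∣ n, f p * (f (n / p) / (1 + countDvd P (n / p) : ℝ))

lemma countDvd_le {P : Finset ℕ} (hP : ∀ p ∈ P, p.Prime) {n p : ℕ} (hp : p ∈ P) (hpn : p ∣ n) :
    countDvd P n ≤ 1 + countDvd P (n / p) := by
  have : {q ∈ P | q ∣ n} ⊆ insert p {q ∈ P | q ∣ n / p} := by
    intro q hq
    rw [mem_filter] at hq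
    rw [mem_insert, mem_filter]
    by_cases h : q = p
    · exact Or.inl h
    · refine Or.inr ⟨hq.1, ?_⟩
      have h2 : q ∣ p * (n / p) := by rw [Nat.mul_div_cancel' hpn]; exact hq.2
      exact (Nat.Coprime.dvd_mul_left ((Nat.coprime_primes (hP q hq.1) (hP p hp)).mpr h)).mp h2
  refine (card_le_card this).trans ((card_insert_le _ _).trans ?_)
  rw [add_comm]; rfl

lemma countDvd_eq {P : Finset ℕ} (hP : ∀ p ∈ P, p.Prime) {n p : ℕ} (hp : p ∈ P) (hpn : p ∣ n)
    (hsq : ¬ p ^ 2 ∣ n) : countDvd P n = 1 + countDvd P (n / p) := by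
  refine le_antisymm (countDvd_le hP hp hpn) ?_
  have hnot : p ∉ ({q ∈ P | q ∣ n / p} : Finset ℕ) := by
    rw [mem_filter]
    rintro ⟨-, h⟩
    refine hsq ?_
    rw [sq, ← Nat.mul_div_cancel' hpn]
    exact Nat.mul_dvd_mul_left p h
  have : insert p {q ∈ P | q ∣ n / p} ⊆ {q ∈ P | q ∣ n} := by
    intro q hq
    rw [mem_insert, mem_filter] at hq
    rw [mem_filter]
    rcases hq with rfl | ⟨h1, h2⟩
    · exact ⟨hp, hpn⟩
    · exact ⟨h1, h2.trans (Nat.div_dvd_of_dvd hpn)⟩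
  have h := card_le_card this
  rw [card_insert_of_notMem hnot, add_comm] at h
  exact h

lemma norm_ramare_le_one {P : Finset ℕ} (hP : ∀ p ∈ P, p.Prime) {f : ℕ → ℂ}
    (hf : ∀ n, ‖f n‖ ≤ 1) (n : ℕ) : ‖ramare P f n‖ ≤ 1 := by
  calc ‖ramare P f n‖ ≤ ∑ p ∈ P with p ∣ n, 1 / (countDvd P n : ℝ) := by
        refine (norm_sum_le _ _).trans (sum_le_sum fun p hp => ?_)
        rw [mem_filter] at hp
        have h0 : 0 < countDvd P n := card_pos.mpr ⟨p, mem_filter.mpr hp⟩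
        have h1 : (countDvd P n : ℝ) ≤ 1 + countDvd P (n / p) := by
          exact_mod_cast countDvd_le hP hp.1 hp.2
        have h2 : (0 : ℝ) < countDvd P n := by exact_mod_cast h0
        rw [norm_mul, norm_div, Complex.norm_real, Real.norm_of_nonneg (by positivity)]
        calc _ ≤ 1 * (1 / (1 + countDvd P (n / p) : ℝ)) := by
              gcongr
              · exact hf p
              · exact hf _
          _ ≤ 1 / (countDvd P n : ℝ) := by
              rw [one_mul]; exact one_div_le_one_div_of_le h2 h1
    _ = (countDvd P n : ℝ) * (1 / countDvd P n) := by rw [sum_const, nsmul_eq_mul]; rfl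
    _ ≤ 1 := by rw [mul_one_div]; exact div_self_le_one _

lemma ramare_eq {P : Finset ℕ} (hP : ∀ p ∈ P, p.Prime) {f : ℕ → ℂ}
    (hf : ∀ p m : ℕ, p.Prime → ¬ p ∣ m → f (p * m) = f p * f m) {n : ℕ}
    (hsq : ∀ p ∈ P, ¬ p ^ 2 ∣ n) (hn : ∃ p ∈ P, p ∣ n) : ramare P f n = f n := by
  have h0 : countDvd P n ≠ 0 := by
    obtain ⟨p, hp, hpn⟩ := hn
    exact (card_pos.mpr ⟨p, mem_filter.mpr ⟨hp, hpn⟩⟩).ne'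
  have h1 : ∀ p ∈ P.filter (· ∣ n), f p * (f (n / p) / (1 + countDvd P (n / p) : ℝ)) =
      f n / countDvd P n := by
    intro p hp
    rw [mem_filter] at hp
    have h2 := hf p (n / p) (hP p hp.1) fun h => hsq p hp.1 (by
      rw [sq, ← Nat.mul_div_cancel' hp.2]
      exact Nat.mul_dvd_mul_left p h)
    rw [Nat.mul_div_cancel' hp.2] at h2
    rw [h2, countDvd_eq hP hp.1 hp.2 (hsq p hp.1)]
    push_cast
    ring
  rw [ramare, sum_congr rfl h1, sum_const, nsmul_eq_mul]
  change (countDvd P n : ℂ) * _ = _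
  have : (countDvd P n : ℂ) ≠ 0 := by exact_mod_cast h0
  field_simp

lemma sum_Icc_sum_dvd {α : Type*} [AddCommMonoid α] {P : Finset ℕ} (hP : ∀ p ∈ P, 0 < p) (X : ℕ)
    (G : ℕ → ℕ → α) :
    ∑ n ∈ Icc 1 X, ∑ p ∈ P with p ∣ n, G p (n / p) = ∑ p ∈ P, ∑ k ∈ Icc 1 (X / p), G p k := by
  simp_rw [sum_filter]
  rw [sum_comm]
  refine sum_congr rfl fun p hp => ?_
  rw [← sum_filter]
  have hp0 := hP p hp
  refine sum_bij' (fun n _ => n / p) (fun k _ => p * k) ?_ ?_ ?_ ?_ ?_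
  · intro n hn
    rw [mem_filter, mem_Icc] at hn
    rw [mem_Icc]
    exact ⟨Nat.div_pos (Nat.le_of_dvd (by omega) hn.2) hp0, Nat.div_le_div_right hn.1.2⟩
  · intro k hk
    rw [mem_Icc] at hk
    rw [mem_filter, mem_Icc]
    exact ⟨⟨Nat.mul_pos hp0 hk.1, by rw [mul_comm]; exact (Nat.le_div_iff_mul_le hp0).mp hk.2⟩,
      dvd_mul_right _ _⟩
  · intro n hn
    rw [mem_filter] at hn
    exact Nat.mul_div_cancel' hn.2
  · intro k _
    exact Nat.mul_div_cancel_left k hp0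
  · intro n _; rfl

lemma sum_dyadic (j₀ J : ℕ) (hJ : j₀ ≤ J) (F : ℕ → ℂ) :
    ∑ m ∈ Ico (2 ^ j₀) (2 ^ J), F m = ∑ j ∈ Ico j₀ J, ∑ m ∈ Ico (2 ^ j) (2 * 2 ^ j), F m := by
  induction J, hJ using Nat.le_induction with
  | base => simp
  | succ J hJ ih =>
    rw [sum_Ico_succ_top hJ, ← ih, ← pow_succ']
    exact (sum_Ico_consecutive F (Nat.pow_le_pow_right two_pos hJ)
      (Nat.pow_le_pow_right two_pos (Nat.le_succ J))).symm

lemma sum_ramare_mul {P : Finset ℕ} {j₀ J : ℕ} (hJ : j₀ ≤ J) (hP : P ⊆ Ico (2 ^ j₀) (2 ^ J))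
    (f : ℕ → ℂ) (X : ℕ) {r : ℕ} (χ : DirichletCharacter ℂ r) :
    ∑ n ∈ Icc 1 X, ramare P f n * χ (n : ZMod r) =
      ∑ j ∈ Ico j₀ J, ∑ m ∈ Ico (2 ^ j) (2 * 2 ^ j), ∑ k ∈ Icc 1 (X / m),
        (if m ∈ P then f m else 0) * (f k / (1 + countDvd P k : ℝ)) *
          (χ (m : ZMod r) * χ (k : ZMod r)) := by
  have hpos : ∀ p ∈ P, 0 < p := fun p hp =>
    lt_of_lt_of_le (by positivity) (mem_Ico.mp (hP hp)).1
  rw [← sum_dyadic j₀ J hJ, ← sum_subset hP fun m _ hm => by simp [hm]]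
  have h1 : ∀ n ∈ Icc 1 X, ramare P f n * χ (n : ZMod r) = ∑ p ∈ P with p ∣ n,
      f p * (f (n / p) / (1 + countDvd P (n / p) : ℝ)) *
        (χ (p : ZMod r) * χ ((n / p : ℕ) : ZMod r)) := by
    intro n _
    rw [ramare, sum_mul]
    refine sum_congr rfl fun p hp => ?_
    rw [← map_mul, ← Nat.cast_mul, Nat.mul_div_cancel' (mem_filter.mp hp).2]
  rw [sum_congr rfl h1, sum_Icc_sum_dvd hpos X (fun p k =>
    f p * (f k / (1 + countDvd P k : ℝ)) * (χ (p : ZMod r) * χ (k : ZMod r)))]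
  exact sum_congr rfl fun p hp => sum_congr rfl fun k _ => by rw [if_pos hp]

lemma one_le_four_mul_sqrt_two_sub_one : 1 ≤ 4 * (√2 - 1) := by
  have : (1.25 : ℝ) ≤ √2 := Real.le_sqrt_of_sq_le (by norm_num)
  linarith

lemma sum_sqrt_two_pow_le (j₀ J : ℕ) : ∑ j ∈ Ico j₀ J, √(2 ^ j : ℝ) ≤ 4 * √(2 ^ J : ℝ) := by
  refine (sum_le_sum_of_subset_of_nonneg (t := range J) (fun j hj => by
    rw [mem_Ico] at hj; rw [mem_range]; exact hj.2) fun _ _ _ => by positivity).trans ?_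
  induction J with
  | zero => simp
  | succ J ih =>
    have : √(2 ^ (J + 1) : ℝ) = √(2 ^ J : ℝ) * √2 := by
      rw [pow_succ, Real.sqrt_mul (by positivity)]
    rw [sum_range_succ, this]
    nlinarith [mul_le_mul_of_nonneg_left one_le_four_mul_sqrt_two_sub_one
      (Real.sqrt_nonneg (2 ^ J : ℝ))]

lemma sum_one_div_sqrt_two_pow_le (j₀ J : ℕ) :
    ∑ j ∈ Ico j₀ J, 1 / √(2 ^ j : ℝ) ≤ 4 * (1 / √(2 ^ j₀ : ℝ)) := by
  rcases Nat.lt_or_ge J j₀ with h | h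
  · rw [Ico_eq_empty (by omega), sum_empty]; positivity
  suffices ∑ j ∈ Ico j₀ J, 1 / √(2 ^ j : ℝ) ≤ 4 * (1 / √(2 ^ j₀ : ℝ)) - 4 * (1 / √(2 ^ J : ℝ)) by
    have : (0 : ℝ) ≤ 1 / √(2 ^ J : ℝ) := by positivity
    linarith
  induction J, h using Nat.le_induction with
  | base => simp
  | succ J hJ ih =>
    have h1 : 1 / √(2 ^ J : ℝ) = 1 / √(2 ^ (J + 1) : ℝ) * √2 := by
      rw [pow_succ, Real.sqrt_mul (by positivity)]; field_simp
    rw [sum_Ico_succ_top hJ]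
    have h2 : (0 : ℝ) ≤ 1 / √(2 ^ (J + 1) : ℝ) := by positivity
    have h3 : √2 ≤ 4 * (√2 - 1) := by
      have : (1.4 : ℝ) ≤ √2 := Real.le_sqrt_of_sq_le (by norm_num)
      linarith
    nlinarith [mul_le_mul_of_nonneg_left h3 h2]

/-- The completely multiplicative function `n ↦ n ^ (-σ)`. -/
def negRpowHom (σ : ℝ) : ℕ →* ℝ where
  toFun n := (n : ℝ) ^ (-σ)
  map_one' := by simp
  map_mul' m n := by push_cast; exact Real.mul_rpow (by positivity) (by positivity)

lemma inv_one_sub_le_exp {t : ℝ} (h0 : 0 ≤ t) (h1 : t ≤ 3 / 4) : (1 - t)⁻¹ ≤ Real.exp (4 * t) := by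
  have h2 := Real.add_one_le_exp (4 * t)
  rw [inv_le_iff_one_le_mul₀ (by linarith)]
  nlinarith

lemma sum_primesBelow_rpow_le {σ D : ℝ} (hσ1 : σ ≤ 1) (hD : 1 ≤ D) :
    ∑ p ∈ (⌊D⌋₊ + 1).primesBelow, (p : ℝ) ^ (-σ) ≤ D ^ (1 - σ) * (1 + Real.log D) := by
  have hfl : (⌊D⌋₊ : ℝ) ≤ D := Nat.floor_le (by linarith)
  calc _ ≤ ∑ m ∈ Icc 1 ⌊D⌋₊, (m : ℝ) ^ (-σ) := by
        refine sum_le_sum_of_subset_of_nonneg (fun p hp => ?_) fun _ _ _ => by positivity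
        have h1 := Nat.lt_of_mem_primesBelow hp
        have h2 := (Nat.prime_of_mem_primesBelow hp).one_lt
        rw [mem_Icc]; omega
    _ ≤ ∑ m ∈ Icc 1 ⌊D⌋₊, D ^ (1 - σ) * (1 / m) := by
        refine sum_le_sum fun m hm => ?_
        rw [mem_Icc] at hm
        have hm0 : (0 : ℝ) < m := by exact_mod_cast hm.1
        have hmD : (m : ℝ) ≤ D := le_trans (by exact_mod_cast hm.2) hfl
        have : (m : ℝ) ^ (-σ) = (m : ℝ) ^ (1 - σ) * (1 / m) := by
          rw [one_div, ← Real.rpow_neg_one (m : ℝ), ← Real.rpow_add hm0]; ring_nf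
        rw [this]
        gcongr
    _ = D ^ (1 - σ) * ∑ m ∈ Icc 1 ⌊D⌋₊, (1 / m : ℝ) := by rw [mul_sum]
    _ ≤ _ := by
        gcongr
        refine (sum_one_div_Icc_le _).trans ?_
        have : (0 : ℝ) < ⌊D⌋₊ := by exact_mod_cast Nat.floor_pos.mpr hD
        have := Real.log_le_log this hfl
        linarith

open Classical in
/-- Rankin's upper bound for the number of `D`-smooth integers up to `X`. -/
lemma card_smooth_le {σ D : ℝ} (hσ : 1 / 2 ≤ σ) (hσ1 : σ ≤ 1) (hD : 1 ≤ D) (X : ℕ) :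
    (#{n ∈ Icc 1 X | IsSmooth D n} : ℝ)
      ≤ (X : ℝ) ^ σ * Real.exp (4 * (D ^ (1 - σ) * (1 + Real.log D))) := by
  have hp : ∀ {p : ℕ}, p.Prime → (p : ℝ) ^ (-σ) ≤ 3 / 4 := by
    intro p hp
    have hp2 : (2 : ℝ) ≤ p := by exact_mod_cast hp.two_le
    calc (p : ℝ) ^ (-σ) ≤ (2 : ℝ) ^ (-σ) :=
          Real.rpow_le_rpow_of_nonpos two_pos hp2 (by linarith)
      _ ≤ (2 : ℝ) ^ (-(1 / 2) : ℝ) := Real.rpow_le_rpow_of_exponent_le one_le_two (by linarith)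
      _ ≤ 3 / 4 := by
          rw [Real.rpow_neg two_pos.le, ← Real.sqrt_eq_rpow]
          have : (4 / 3 : ℝ) ≤ √2 := Real.le_sqrt_of_sq_le (by norm_num)
          rw [inv_le_comm₀ (by positivity) (by norm_num)]
          norm_num; linarith
  set s : Finset ℕ := {n ∈ Icc 1 X | IsSmooth D n} with hs
  have hmem : ∀ n ∈ s, n ∈ Nat.smoothNumbers (⌊D⌋₊ + 1) := by
    intro n hn
    rw [hs, mem_filter, mem_Icc] at hn
    rw [Nat.mem_smoothNumbers']
    intro p hp hpn
    exact Nat.lt_succ_of_le (Nat.le_floor (hn.2 p hp hpn))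
  have hsum := (EulerProduct.summable_and_hasSum_smoothNumbers_prod_primesBelow_geometric
    (f := negRpowHom σ) (fun {p} hp' => by
      have := hp hp'
      change ‖(p : ℝ) ^ (-σ)‖ < 1
      rw [Real.norm_of_nonneg (by positivity)]; linarith) (⌊D⌋₊ + 1)).2
  have h1 : ∑ n ∈ s, (n : ℝ) ^ (-σ) ≤ Real.exp (4 * (D ^ (1 - σ) * (1 + Real.log D))) := by
    calc ∑ n ∈ s, (n : ℝ) ^ (-σ)
        = ∑ n ∈ s.subtype (· ∈ Nat.smoothNumbers (⌊D⌋₊ + 1)), negRpowHom σ n :=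
          (sum_subtype_of_mem (fun n : ℕ => (n : ℝ) ^ (-σ)) hmem).symm
      _ ≤ ∏ p ∈ (⌊D⌋₊ + 1).primesBelow, (1 - negRpowHom σ p)⁻¹ :=
          sum_le_hasSum _ (fun n _ => Real.rpow_nonneg (Nat.cast_nonneg _) _) hsum
      _ ≤ ∏ p ∈ (⌊D⌋₊ + 1).primesBelow, Real.exp (4 * (p : ℝ) ^ (-σ)) := by
          refine prod_le_prod (fun p hp' => ?_) fun p hp' => ?_
          · have := hp (Nat.prime_of_mem_primesBelow hp')
            change 0 ≤ (1 - (p : ℝ) ^ (-σ))⁻¹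
            rw [inv_nonneg]; linarith
          · exact inv_one_sub_le_exp (Real.rpow_nonneg (Nat.cast_nonneg p) _)
              (hp (Nat.prime_of_mem_primesBelow hp'))
      _ = Real.exp (4 * ∑ p ∈ (⌊D⌋₊ + 1).primesBelow, (p : ℝ) ^ (-σ)) := by
          rw [← Real.exp_sum, mul_sum]
      _ ≤ _ := by
          gcongr
          exact sum_primesBelow_rpow_le hσ1 hD
  calc (#s : ℝ) = ∑ n ∈ s, (1 : ℝ) := by simp
    _ ≤ ∑ n ∈ s, (X : ℝ) ^ σ * (n : ℝ) ^ (-σ) := by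
        refine sum_le_sum fun n hn => ?_
        rw [hs, mem_filter, mem_Icc] at hn
        have hn0 : (0 : ℝ) < n := by exact_mod_cast hn.1.1
        rw [Real.rpow_neg hn0.le, ← div_eq_mul_inv, le_div_iff₀ (by positivity), one_mul]
        have : (n : ℝ) ≤ X := by exact_mod_cast hn.1.2
        exact Real.rpow_le_rpow hn0.le this (by linarith)
    _ = (X : ℝ) ^ σ * ∑ n ∈ s, (n : ℝ) ^ (-σ) := by rw [mul_sum]
    _ ≤ _ := by gcongr

open Classical in
lemma card_exists_sq_dvd_le {P : Finset ℕ} {D : ℝ} (hD : 1 ≤ D) (hP : ∀ p ∈ P, D < p) (X : ℕ) :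
    (#{n ∈ Icc 1 X | ∃ p ∈ P, p ^ 2 ∣ n} : ℝ) ≤ 2 * X / D := by
  have hsub : {n ∈ Icc 1 X | ∃ p ∈ P, p ^ 2 ∣ n} ⊆
      P.biUnion fun p => {n ∈ Ioc 0 X | p ^ 2 ∣ n} := by
    intro n hn
    simp only [mem_filter, mem_Icc] at hn
    obtain ⟨hn1, p, hp, hpn⟩ := hn
    rw [mem_biUnion]
    exact ⟨p, hp, mem_filter.mpr ⟨mem_Ioc.mpr ⟨hn1.1, hn1.2⟩, hpn⟩⟩
  set k := ⌊D⌋₊ with hk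
  have hk1 : 1 ≤ k := Nat.floor_pos.mpr hD
  have hk1' : (1 : ℝ) ≤ k := by exact_mod_cast hk1
  have hkD : D ≤ 2 * k := by
    have := Nat.lt_floor_add_one D
    linarith
  have hPk : ∀ p ∈ P, k < p := fun p hp => (Nat.floor_lt (by linarith)).mpr (hP p hp)
  set M := k + P.sup id with hM
  have hPM : P ⊆ Ioc k M := fun p hp => by
    rw [mem_Ioc]
    have : p ≤ P.sup id := le_sup (f := id) hp
    exact ⟨hPk p hp, by omega⟩
  calc (#{n ∈ Icc 1 X | ∃ p ∈ P, p ^ 2 ∣ n} : ℝ)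
      ≤ ((∑ p ∈ P, #{n ∈ Ioc 0 X | p ^ 2 ∣ n} : ℕ) : ℝ) := by
        exact_mod_cast (card_le_card hsub).trans card_biUnion_le
    _ ≤ ∑ p ∈ P, (X : ℝ) * ((p : ℝ) ^ 2)⁻¹ := by
        push_cast
        refine sum_le_sum fun p _ => ?_
        rw [Nat.Ioc_filter_dvd_card_eq_div, ← div_eq_mul_inv]
        exact_mod_cast Nat.cast_div_le (α := ℝ) (m := X) (n := p ^ 2)
    _ ≤ ∑ p ∈ Ioc k M, (X : ℝ) * ((p : ℝ) ^ 2)⁻¹ :=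
        sum_le_sum_of_subset_of_nonneg hPM fun _ _ _ => by positivity
    _ = X * ∑ p ∈ Ioc k M, ((p : ℝ) ^ 2)⁻¹ := by rw [mul_sum]
    _ ≤ X * (k : ℝ)⁻¹ := by
        gcongr
        have := sum_Ioc_inv_sq_le_sub (α := ℝ) (k := k) (n := M) (by omega) (by omega)
        have h0 : (0 : ℝ) ≤ (M : ℝ)⁻¹ := by positivity
        linarith
    _ ≤ _ := by
        rw [← div_eq_mul_inv, div_le_div_iff₀ (by linarith) (by linarith)]
        nlinarith [X.cast_nonneg (α := ℝ)]

lemma half_le_prod_one_sub_inv_sq (s : Finset ℕ) (hs : ∀ p ∈ s, 2 ≤ p) :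
    (1 / 2 : ℝ) ≤ ∏ p ∈ s, (1 - ((p : ℝ) ^ 2)⁻¹) := by
  have hnn : ∀ p : ℕ, 2 ≤ p → 0 ≤ 1 - ((p : ℝ) ^ 2)⁻¹ := by
    intro p hp
    have : (2 : ℝ) ≤ p := by exact_mod_cast hp
    rw [sub_nonneg]
    exact inv_le_one_of_one_le₀ (by nlinarith)
  set M := s.sup id + 2 with hM
  have hsub : s ⊆ Ico 2 M := fun p hp => by
    have : p ≤ s.sup id := le_sup (f := id) hp
    rw [mem_Ico]
    exact ⟨hs p hp, by omega⟩
  have htel : ∀ M : ℕ, 2 ≤ M →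
      (1 / 2 : ℝ) * (1 + 1 / ((M : ℝ) - 1)) = ∏ p ∈ Ico 2 M, (1 - ((p : ℝ) ^ 2)⁻¹) := by
    intro M hM
    induction M, hM using Nat.le_induction with
    | base => norm_num
    | succ M hM ih =>
      have : (2 : ℝ) ≤ M := by exact_mod_cast hM
      have h1 : (M : ℝ) - 1 ≠ 0 := by linarith
      have h2 : (M : ℝ) ≠ 0 := by linarith
      rw [prod_Ico_succ_top hM, ← ih]
      push_cast
      rw [add_sub_cancel_right]
      field_simp
      ring
  calc (1 / 2 : ℝ) ≤ (1 / 2 : ℝ) * (1 + 1 / ((M : ℝ) - 1)) := by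
        have : (2 : ℝ) ≤ M := by exact_mod_cast (by omega : 2 ≤ M)
        have : 0 ≤ 1 / ((M : ℝ) - 1) := div_nonneg zero_le_one (by linarith)
        linarith
    _ = _ := htel M (by omega)
    _ ≤ _ := by
        rw [← prod_sdiff hsub]
        refine mul_le_of_le_one_left (prod_nonneg fun p hp => hnn p (hs p hp)) ?_
        refine prod_le_one (fun p hp => ?_) fun p hp => ?_
        · rw [mem_sdiff, mem_Ico] at hp
          exact hnn p hp.1.1
        · have : (0 : ℝ) ≤ ((p : ℝ) ^ 2)⁻¹ := by positivity
          linarith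

lemma one_div_totient_le {n : ℕ} (hn : 0 < n) :
    (1 / n.totient : ℝ) ≤ 2 * (1 / n * ∑ d ∈ n.divisors, (1 / d : ℝ)) := by
  have hn0 : (0 : ℝ) < n := by exact_mod_cast hn
  have hφ0 : (0 : ℝ) < n.totient := by exact_mod_cast Nat.totient_pos.mpr hn
  have hφ : (n.totient : ℝ) = n * ∏ p ∈ n.primeFactors, (1 - (p : ℝ)⁻¹) := by
    have := Nat.totient_eq_mul_prod_factors n
    have h2 := congrArg (fun q : ℚ => (q : ℝ)) this
    push_cast at h2
    exact h2
  have hdiv : ∏ p ∈ n.primeFactors, (1 + (p : ℝ)⁻¹) ≤ ∑ d ∈ n.divisors, (1 / d : ℝ) := by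
    rw [prod_one_add]
    have hinj : Set.InjOn (fun t : Finset ℕ => ∏ p ∈ t, p) (n.primeFactors.powerset : Set _) := by
      intro t ht u hu htu
      rw [mem_coe, mem_powerset] at ht hu
      have h1 := Nat.primeFactors_prod fun p hp => Nat.prime_of_mem_primeFactors (ht hp)
      have h2 := Nat.primeFactors_prod fun p hp => Nat.prime_of_mem_primeFactors (hu hp)
      rw [← h1, ← h2]
      exact congrArg _ htu
    have h3 : ∑ t ∈ n.primeFactors.powerset, ∏ p ∈ t, (p : ℝ)⁻¹ =
        ∑ d ∈ n.primeFactors.powerset.image (fun t : Finset ℕ => ∏ p ∈ t, p), (1 / d : ℝ) := by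
      rw [sum_image hinj]
      refine sum_congr rfl fun t _ => ?_
      rw [prod_inv_distrib, one_div]; push_cast; rfl
    rw [h3]
    refine sum_le_sum_of_subset_of_nonneg (fun d hd => ?_) fun _ _ _ => by positivity
    rw [mem_image] at hd
    obtain ⟨t, ht, rfl⟩ := hd
    rw [mem_powerset] at ht
    rw [Nat.mem_divisors]
    exact ⟨(prod_dvd_prod_of_subset _ _ _ ht).trans (Nat.prod_primeFactors_dvd n), hn.ne'⟩
  have hhalf := half_le_prod_one_sub_inv_sq n.primeFactors
    fun p hp => (Nat.prime_of_mem_primeFactors hp).two_le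
  have hprod : ∏ p ∈ n.primeFactors, (1 - ((p : ℝ) ^ 2)⁻¹) =
      (∏ p ∈ n.primeFactors, (1 - (p : ℝ)⁻¹)) * ∏ p ∈ n.primeFactors, (1 + (p : ℝ)⁻¹) := by
    rw [← prod_mul_distrib]
    refine prod_congr rfl fun p _ => ?_
    rw [← inv_pow]; ring
  rw [div_le_iff₀ hφ0, hφ]
  set S := ∑ d ∈ n.divisors, (1 / d : ℝ)
  set U := ∏ p ∈ n.primeFactors, (1 - (p : ℝ)⁻¹)
  have hU : 0 ≤ U := by
    rw [hφ] at hφ0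
    exact (pos_of_mul_pos_right hφ0 hn0.le).le
  have : 2 * (1 / n * S) * (n * U) = 2 * (U * S) := by field_simp
  rw [this]
  rw [hprod] at hhalf
  nlinarith [mul_le_mul_of_nonneg_left hdiv hU]

lemma sum_one_div_totient_le (N : ℕ) :
    ∑ n ∈ Icc 1 N, (1 / n.totient : ℝ) ≤ 4 * (1 + Real.log N) := by
  have hH : ∑ k ∈ Icc 1 N, (1 / k : ℝ) ≤ 1 + Real.log N := sum_one_div_Icc_le N
  have hlog : 0 ≤ Real.log N := Real.log_natCast_nonneg N
  calc _ ≤ ∑ n ∈ Icc 1 N, 2 * (1 / n * ∑ d ∈ n.divisors, (1 / d : ℝ)) :=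
        sum_le_sum fun n hn => one_div_totient_le (mem_Icc.mp hn).1
    _ = 2 * ∑ n ∈ Icc 1 N, ∑ d ∈ n.divisors, (1 / n * (1 / d) : ℝ) := by
        simp_rw [mul_sum]
    _ ≤ 2 * ∑ d ∈ Icc 1 N, ∑ k ∈ Icc 1 N, (1 / (d : ℝ) ^ 2 * (1 / k)) := by
        refine mul_le_mul_of_nonneg_left ?_ two_pos.le
        have h1 : ∀ n ∈ Icc 1 N, ∑ d ∈ n.divisors, (1 / n * (1 / d) : ℝ) =
            ∑ d ∈ Icc 1 N with d ∣ n, (1 / (d : ℝ) ^ 2 * (1 / (n / d : ℕ))) := by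
          intro n hn
          rw [mem_Icc] at hn
          have h2 : n.divisors = {d ∈ Icc 1 N | d ∣ n} := by
            ext d
            rw [Nat.mem_divisors, mem_filter, mem_Icc]
            refine ⟨fun h => ⟨⟨Nat.pos_of_dvd_of_pos h.1 hn.1,
              (Nat.le_of_dvd hn.1 h.1).trans hn.2⟩, h.1⟩, fun h => ⟨h.2, by omega⟩⟩
          rw [h2]
          refine sum_congr rfl fun d hd => ?_
          rw [mem_filter, mem_Icc] at hd
          have hd0 : (d : ℝ) ≠ 0 := by
            have : d ≠ 0 := by omega
            exact_mod_cast this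
          rw [Nat.cast_div hd.2 hd0]
          field_simp
        rw [sum_congr rfl h1, sum_Icc_sum_dvd (fun p hp => (mem_Icc.mp hp).1) N
          (fun d k => (1 / (d : ℝ) ^ 2 * (1 / (k : ℕ))))]
        refine sum_le_sum fun d _ => sum_le_sum_of_subset_of_nonneg
          (Icc_subset_Icc_right (Nat.div_le_self N d)) fun _ _ _ => by positivity
    _ ≤ 2 * ∑ d ∈ Icc 1 N, (1 / (d : ℝ) ^ 2 * (1 + Real.log N)) := by
        gcongr with d _
        rw [← mul_sum]
        gcongr
    _ = 2 * ((1 + Real.log N) * ∑ d ∈ Icc 1 N, 1 / (d : ℝ) ^ 2) := by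
        rw [← sum_mul, mul_comm (1 + Real.log N)]
    _ ≤ 2 * ((1 + Real.log N) * 2) := by
        gcongr
        rcases Nat.eq_zero_or_pos N with rfl | hN
        · simp
        have h1 : Icc 1 N = insert 1 (Ioc 1 N) := by
          ext n; simp only [mem_Icc, mem_insert, mem_Ioc]; omega
        rw [h1, sum_insert (by simp)]
        have h2 := sum_Ioc_inv_sq_le_sub (α := ℝ) (k := 1) (n := N) one_ne_zero hN
        have h0 : (0 : ℝ) ≤ (N : ℝ)⁻¹ := by positivity
        simp only [one_div]
        norm_num at h2 ⊢
        linarith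
    _ = _ := by ring

open Classical in
/-- The weighted first moment of the sums `∑ n ≤ X, c n * χ n` over the primitive characters `χ`
whose modulus is in `s`. -/
def primMoment (s : Finset ℕ) (X : ℕ) (c : ℕ → ℂ) : ℝ :=
  ∑ r ∈ s, (1 / r.totient : ℝ) * ∑ χ : DirichletCharacter ℂ r with χ.IsPrimitive,
    ‖∑ n ∈ Icc 1 X, c n * χ (n : ZMod r)‖

lemma primMoment_add_le (s : Finset ℕ) (X : ℕ) (c d : ℕ → ℂ) :
    primMoment s X (fun n => c n + d n) ≤ primMoment s X c + primMoment s X d := by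
  simp only [primMoment]
  rw [← sum_add_distrib]
  refine sum_le_sum fun r _ => ?_
  rw [← mul_add, ← sum_add_distrib]
  refine mul_le_mul_of_nonneg_left (sum_le_sum fun χ _ => ?_) (by positivity)
  simp_rw [add_mul]
  rw [sum_add_distrib]
  exact norm_add_le _ _

/-- The primes in the interval `(D, y]`. -/
def primesIoc (D y : ℝ) : Finset ℕ :=
  open Classical in {p ∈ Icc 1 ⌊y⌋₊ | p.Prime ∧ D < p}

lemma mem_primesIoc {D y : ℝ} {p : ℕ} (hp : p.Prime) (h1 : D < p) (h2 : (p : ℝ) ≤ y) :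
    p ∈ primesIoc D y := by
  classical
  rw [primesIoc, mem_filter, mem_Icc]
  exact ⟨⟨hp.pos, Nat.le_floor h2⟩, hp, h1⟩

lemma prime_of_mem_primesIoc {D y : ℝ} {p : ℕ} (h : p ∈ primesIoc D y) : p.Prime := by
  classical
  exact (mem_filter.mp h).2.1

lemma lt_of_mem_primesIoc {D y : ℝ} {p : ℕ} (h : p ∈ primesIoc D y) : D < p := by
  classical
  exact (mem_filter.mp h).2.2

lemma primesIoc_subset {D y : ℝ} (hD : 1 ≤ D) :
    primesIoc D y ⊆ Ico (2 ^ Nat.log 2 ⌊D⌋₊) (2 ^ (Nat.log 2 ⌊y⌋₊ + 1)) := by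
  classical
  intro p hp
  rw [primesIoc, mem_filter, mem_Icc] at hp
  rw [mem_Ico]
  constructor
  · refine (Nat.pow_log_le_self 2 (Nat.floor_pos.mpr hD).ne').trans ?_
    exact (Nat.floor_lt (by linarith)).mpr hp.2.2 |>.le
  · exact lt_of_le_of_lt hp.1.2 (Nat.lt_pow_succ_log_self one_lt_two _)

lemma nat_log_two_le {n : ℕ} (hn : 1 ≤ n) : (Nat.log 2 n : ℝ) ≤ 2 * Real.log n := by
  have h1 : ((2 ^ Nat.log 2 n : ℕ) : ℝ) ≤ n := by exact_mod_cast Nat.pow_log_le_self 2 (by omega)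
  have h2 := Real.log_le_log (by positivity) h1
  push_cast at h2
  rw [Real.log_pow] at h2
  have h3 : 1 / 2 ≤ Real.log 2 := by linarith [Real.log_two_gt_d9]
  nlinarith [(Nat.log 2 n).cast_nonneg (α := ℝ)]

/-- The contribution of the main term of Ramaré's identity. -/
theorem exists_primMoment_ramare_le : ∃ C : ℝ, 0 < C ∧ ∀ (R X : ℕ) (D y : ℝ) (f : ℕ → ℂ), 1 ≤ R →
    1 ≤ X → 1 ≤ D → D ≤ y → (∀ n, ‖f n‖ ≤ 1) →
    primMoment (Ico R (2 * R)) X (ramare (primesIoc D y) f)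
      ≤ C * (3 + 2 * Real.log X) *
        ((1 + 2 * Real.log y) * (X / R + R * √X) + √X * √y + X / √D) := by
  obtain ⟨C, hC, hhyp⟩ := exists_sum_hyperbola_le
  refine ⟨8 * C, by positivity, fun R X D y f hR hX hD hDy hf => ?_⟩
  have hX1 : (1 : ℝ) ≤ X := by exact_mod_cast hX
  have hR0 : (0 : ℝ) < R := by exact_mod_cast hR
  have hlogX : 0 ≤ Real.log X := Real.log_nonneg hX1
  have hy : 1 ≤ y := hD.trans hDy
  have hlogy : 0 ≤ Real.log y := Real.log_nonneg hy
  set P := primesIoc D y with hP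
  set j₀ := Nat.log 2 ⌊D⌋₊ with hj₀
  set J := Nat.log 2 ⌊y⌋₊ + 1 with hJ
  have hj₀J : j₀ ≤ J := (Nat.log_mono_right (Nat.floor_le_floor hDy)).trans (Nat.le_succ _)
  have hfl : (⌊y⌋₊ : ℝ) ≤ y := Nat.floor_le (by linarith)
  have hfl1 : 1 ≤ ⌊y⌋₊ := Nat.floor_pos.mpr hy
  have hfl0 : (0 : ℝ) < ⌊y⌋₊ := by exact_mod_cast hfl1
  have hJle : (J : ℝ) ≤ 1 + 2 * Real.log y := by
    have h1 := nat_log_two_le hfl1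
    have h2 := Real.log_le_log hfl0 hfl
    rw [hJ]; push_cast; linarith
  have h2J : √(2 ^ J : ℝ) ≤ 2 * √y := by
    rw [Real.sqrt_le_left (by positivity), mul_pow, Real.sq_sqrt (by linarith)]
    have : ((2 ^ Nat.log 2 ⌊y⌋₊ : ℕ) : ℝ) ≤ ⌊y⌋₊ := by
      exact_mod_cast Nat.pow_log_le_self 2 (by omega)
    push_cast at this
    rw [hJ, pow_succ]; linarith
  have h2j₀ : 1 / √(2 ^ j₀ : ℝ) ≤ 2 * (1 / √D) := by
    have hD' : D ≤ 2 * 2 ^ j₀ := by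
      have h1 : ⌊D⌋₊ + 1 ≤ 2 ^ (j₀ + 1) := Nat.lt_pow_succ_log_self one_lt_two _
      have h2 : ((⌊D⌋₊ + 1 : ℕ) : ℝ) ≤ ((2 ^ (j₀ + 1) : ℕ) : ℝ) := by exact_mod_cast h1
      push_cast at h2
      have := Nat.lt_floor_add_one D
      rw [pow_succ] at h2; linarith
    have h3 : √D ≤ 2 * √(2 ^ j₀ : ℝ) := by
      rw [Real.sqrt_le_left (by positivity), mul_pow, Real.sq_sqrt (by positivity)]
      have : (0 : ℝ) ≤ 2 ^ j₀ := by positivity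
      linarith
    rw [mul_one_div, div_le_div_iff₀ (by positivity) (by positivity)]
    linarith
  set a : ℕ → ℂ := fun m => if m ∈ P then f m else 0 with ha
  set b : ℕ → ℂ := fun k => f k / (1 + countDvd P k : ℝ) with hb
  have hna : ∀ n, ‖a n‖ ≤ 1 := by
    intro n; simp only [ha]; split_ifs
    · exact hf n
    · simp
  have hnb : ∀ n, ‖b n‖ ≤ 1 := by
    intro n
    simp only [hb, norm_div, Complex.norm_real]
    rw [Real.norm_of_nonneg (by positivity)]
    have h0 : (0 : ℝ) ≤ countDvd P n := Nat.cast_nonneg _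
    exact div_le_one_of_le₀ ((hf n).trans (by linarith)) (by positivity)
  calc primMoment (Ico R (2 * R)) X (ramare P f)
      ≤ ∑ j ∈ Ico j₀ J, C * (3 + 2 * Real.log X) *
          (X / R + √X * √((2 ^ j : ℕ) : ℝ) + X / √((2 ^ j : ℕ) : ℝ) + R * √X) := by
        classical
        refine le_trans ?_ (sum_le_sum fun j _ =>
          hhyp R (2 ^ j) X a b hR Nat.one_le_two_pow hX hna hnb)
        rw [primMoment, sum_comm]
        refine sum_le_sum fun r _ => ?_
        rw [← mul_sum, sum_comm]
        refine mul_le_mul_of_nonneg_left (sum_le_sum fun χ _ => ?_) (by positivity)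
        rw [sum_ramare_mul hj₀J (primesIoc_subset hD)]
        exact norm_sum_le _ _
    _ = C * (3 + 2 * Real.log X) * (∑ _j ∈ Ico j₀ J, (X / R + R * √X) +
          √X * ∑ j ∈ Ico j₀ J, √(2 ^ j : ℝ) + X * ∑ j ∈ Ico j₀ J, 1 / √(2 ^ j : ℝ)) := by
        rw [mul_sum, mul_sum, ← sum_add_distrib, ← sum_add_distrib, ← mul_sum]
        congr 1
        refine sum_congr rfl fun j _ => ?_
        push_cast; ring
    _ ≤ C * (3 + 2 * Real.log X) * ((1 + 2 * Real.log y) * (X / R + R * √X) +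
          √X * (8 * √y) + X * (8 * (1 / √D))) := by
        gcongr
        · rw [sum_const, Nat.card_Ico, nsmul_eq_mul]
          refine mul_le_mul_of_nonneg_right (le_trans ?_ hJle) (by positivity)
          exact_mod_cast Nat.sub_le J j₀
        · exact (sum_sqrt_two_pow_le j₀ J).trans (by linarith)
        · exact (sum_one_div_sqrt_two_pow_le j₀ J).trans (by linarith)
    _ ≤ C * (3 + 2 * Real.log X) * (8 * ((1 + 2 * Real.log y) * (X / R + R * √X) +
          √X * √y + X / √D)) := by
        gcongr
        have : 0 ≤ (1 + 2 * Real.log y) * (X / R + R * √X) := by positivity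
        rw [show (X : ℝ) * (8 * (1 / √D)) = 8 * (X / √D) by ring]
        linarith
    _ = _ := by ring

open Classical in
lemma sum_norm_sq_sub_ramare_le {X : ℕ} {D y : ℝ} {f : ℕ → ℂ} (hD : 1 ≤ D)
    (hf : ∀ n, ‖f n‖ ≤ 1) (hmul : ∀ p m : ℕ, p.Prime → ¬ p ∣ m → f (p * m) = f p * f m)
    (hsupp : ∀ n, f n ≠ 0 → IsSmooth y n) :
    ∑ n ∈ Icc 1 X, ‖f n - ramare (primesIoc D y) f n‖ ^ 2
      ≤ 4 * (#{n ∈ Icc 1 X | IsSmooth D n} + 2 * X / D) := by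
  set P := primesIoc D y with hP
  have hprime : ∀ p ∈ P, p.Prime := fun p hp => prime_of_mem_primesIoc hp
  have hzero : ∀ n, ¬ IsSmooth D n → (¬ ∃ p ∈ P, p ^ 2 ∣ n) → f n - ramare P f n = 0 := by
    intro n hn hsq
    push Not at hsq
    by_cases h : ∃ p ∈ P, p ∣ n
    · rw [ramare_eq hprime hmul hsq h, sub_self]
    · have h1 : ramare P f n = 0 := by
        rw [ramare, filter_eq_empty_iff.mpr, sum_empty]
        exact fun p hp hpn => h ⟨p, hp, hpn⟩
      have h2 : f n = 0 := by
        by_contra h0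
        rw [IsSmooth] at hn
        push Not at hn
        obtain ⟨p, hp, hpn, hpD⟩ := hn
        exact h ⟨p, mem_primesIoc hp hpD (hsupp n h0 p hp hpn), hpn⟩
      rw [h1, h2, sub_zero]
  have hbound : ∀ n, ‖f n - ramare P f n‖ ^ 2 ≤ 4 := by
    intro n
    have h1 := (norm_sub_le (f n) (ramare P f n)).trans
      (add_le_add (hf n) (norm_ramare_le_one hprime hf n))
    nlinarith [norm_nonneg (f n - ramare P f n)]
  calc _ ≤ ∑ n ∈ Icc 1 X, ((if IsSmooth D n then (4 : ℝ) else 0) +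
        (if ∃ p ∈ P, p ^ 2 ∣ n then (4 : ℝ) else 0)) := by
        refine sum_le_sum fun n _ => ?_
        by_cases h1 : IsSmooth D n
        · rw [if_pos h1]
          have := hbound n
          split_ifs <;> linarith
        · by_cases h2 : ∃ p ∈ P, p ^ 2 ∣ n
          · rw [if_pos h2, if_neg h1]
            linarith [hbound n]
          · rw [hzero n h1 h2, if_neg h1, if_neg h2]; simp
    _ = 4 * (#{n ∈ Icc 1 X | IsSmooth D n} + #{n ∈ Icc 1 X | ∃ p ∈ P, p ^ 2 ∣ n}) := by
        rw [sum_add_distrib, ← sum_filter, ← sum_filter, sum_const, sum_const, nsmul_eq_mul,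
          nsmul_eq_mul]
        ring
    _ ≤ _ := by
        gcongr
        exact card_exists_sq_dvd_le hD (fun p hp => lt_of_mem_primesIoc hp) X

open Classical in
/-- The first moment of character sums of a multiplicative function supported on smooth numbers,
over a dyadic range of moduli. -/
theorem exists_primMoment_le : ∃ C : ℝ, 0 < C ∧ ∀ (R X : ℕ) (D y : ℝ) (f : ℕ → ℂ), 1 ≤ R →
    1 ≤ X → 1 ≤ D → D ≤ y → (∀ n, ‖f n‖ ≤ 1) →
    (∀ p m : ℕ, p.Prime → ¬ p ∣ m → f (p * m) = f p * f m) →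
    (∀ n, f n ≠ 0 → IsSmooth y n) →
    primMoment (Ico R (2 * R)) X f
      ≤ C * (3 + 2 * Real.log X) *
        ((1 + 2 * Real.log y) * (X / R + R * √X) + √X * √y + X / √D) +
        C * √((X + (R : ℝ) ^ 2) * (#{n ∈ Icc 1 X | IsSmooth D n} + X / D)) := by
  obtain ⟨C₁, hC₁, h₁⟩ := exists_primMoment_ramare_le
  obtain ⟨C₂, hC₂, h₂⟩ := exists_sum_primitive_norm_le
  refine ⟨C₁ + 3 * C₂, by positivity, fun R X D y f hR hX hD hDy hf hmul hsupp => ?_⟩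
  have hX1 : (1 : ℝ) ≤ X := by exact_mod_cast hX
  have hlogX : 0 ≤ Real.log X := Real.log_nonneg hX1
  have hlogy : 0 ≤ Real.log y := Real.log_nonneg (hD.trans hDy)
  have h3 := primMoment_add_le (Ico R (2 * R)) X (ramare (primesIoc D y) f)
    (fun n => f n - ramare (primesIoc D y) f n)
  simp only [add_sub_cancel] at h3
  have h4 := h₁ R X D y f hR hX hD hDy hf
  have h5 : primMoment (Ico R (2 * R)) X (fun n => f n - ramare (primesIoc D y) f n) ≤
      3 * C₂ * √((X + (R : ℝ) ^ 2) * (#{n ∈ Icc 1 X | IsSmooth D n} + X / D)) := by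
    refine (h₂ R X (fun n => f n - ramare (primesIoc D y) f n) hR).trans ?_
    rw [mul_comm 3 C₂, mul_assoc]
    refine mul_le_mul_of_nonneg_left ?_ hC₂.le
    rw [← Real.sqrt_sq (by norm_num : (0 : ℝ) ≤ 3), ← Real.sqrt_mul (by positivity)]
    refine Real.sqrt_le_sqrt ?_
    have h6 := sum_norm_sq_sub_ramare_le (X := X) hD hf hmul hsupp
    have h7 : (0 : ℝ) ≤ #{n ∈ Icc 1 X | IsSmooth D n} := Nat.cast_nonneg _
    calc _ ≤ (X + (R : ℝ) ^ 2) * (4 * (#{n ∈ Icc 1 X | IsSmooth D n} + 2 * X / D)) := by gcongr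
      _ ≤ (X + (R : ℝ) ^ 2) * (9 * (#{n ∈ Icc 1 X | IsSmooth D n} + X / D)) := by
          refine mul_le_mul_of_nonneg_left ?_ (by positivity)
          have h8 : (0 : ℝ) ≤ X / D := by positivity
          rw [mul_div_assoc]
          linarith
      _ = _ := by ring
  refine (h3.trans (add_le_add h4 h5)).trans ?_
  gcongr <;> linarith

lemma mem_inducedChars_of_conductor_le {T : ℝ} {q : ℕ} [NeZero q] (χ : DirichletCharacter ℂ q)
    (h : (χ.conductor : ℝ) ≤ T) : χ ∈ inducedChars (primitiveUpTo T) q := by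
  refine ⟨⟨χ.conductor, χ.primitiveCharacter⟩, ⟨Nat.pos_of_ne_zero χ.conductor_ne_zero,
    χ.primitiveCharacter_isPrimitive, ?_⟩, χ.conductor_dvd_level,
    χ.changeLevel_primitiveCharacter.symm⟩
  have := (DirichletCharacter.isPrimitive_def _).mp χ.primitiveCharacter_isPrimitive
  dsimp only
  rw [this]
  exact h

lemma norm_charSum (f : ArithmeticFunction ℂ) (x : ℝ) {q : ℕ} (χ : DirichletCharacter ℂ q) :
    ‖charSum f x χ‖ = ‖∑ n ∈ Icc 1 ⌊x⌋₊, (starRingEnd ℂ) (f n) * χ (n : ZMod q)‖ := by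
  rw [← RCLike.norm_conj, charSum, map_sum]
  simp_rw [map_mul, RCLike.conj_conj]

open Classical in
lemma sum_modEq_eq (f : ArithmeticFunction ℂ) (x : ℝ) {q : ℕ} [NeZero q] (a : (ZMod q)ˣ) :
    ∑ n ∈ Icc 1 ⌊x⌋₊ with ((n : ℕ) : ZMod q) = a, f n =
      1 / (q.totient : ℂ) * ∑ χ : DirichletCharacter ℂ q, χ a * charSum f x χ := by
  have hφ : (q.totient : ℂ) ≠ 0 := by
    exact_mod_cast (Nat.totient_pos.mpr (Nat.pos_of_ne_zero (NeZero.ne q))).ne'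
  simp_rw [charSum, mul_sum]
  rw [sum_comm, sum_filter]
  refine sum_congr rfl fun n _ => ?_
  have h1 : ∀ χ : DirichletCharacter ℂ q,
      1 / (q.totient : ℂ) * (χ a * (f n * (starRingEnd ℂ) (χ (n : ZMod q)))) =
        f n / q.totient * (starRingEnd ℂ) (χ (a : ZMod q)⁻¹ * χ (n : ZMod q)) := by
    intro χ
    rw [map_mul, conj_dirichletCharacter_apply χ (a : ZMod q)⁻¹, MulChar.inv_apply,
      ZMod.inv_coe_unit, Ring.inverse_unit, inv_inv]
    ring
  simp_rw [h1]
  rw [← mul_sum, ← map_sum, DirichletCharacter.sum_char_inv_mul_char_eq ℂ a.isUnit]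
  by_cases h : (n : ZMod q) = a
  · rw [if_pos h, if_pos h.symm]
    simp [hφ]
  · rw [if_neg h, if_neg (Ne.symm h)]
    simp

open Classical in
lemma norm_Delta_le (f : ArithmeticFunction ℂ) (x T : ℝ) {q : ℕ} [NeZero q] (a : (ZMod q)ˣ) :
    ‖Delta (primitiveUpTo T) f x q a‖ ≤ (1 / q.totient : ℝ) *
      ∑ χ : DirichletCharacter ℂ q with T < χ.conductor,
        ‖∑ n ∈ Icc 1 ⌊x⌋₊, (starRingEnd ℂ) (f n) * χ (n : ZMod q)‖ := by
  rw [Delta, sum_modEq_eq, ← mul_sub, norm_mul, norm_div, norm_one, Complex.norm_natCast]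
  refine mul_le_mul_of_nonneg_left ?_ (by positivity)
  have h1 := sum_filter_add_sum_filter_not (univ : Finset (DirichletCharacter ℂ q))
    (fun χ => χ ∈ inducedChars (primitiveUpTo T) q) (fun χ => χ a * charSum f x χ)
  rw [← h1, add_sub_cancel_left]
  refine (norm_sum_le _ _).trans ?_
  refine (sum_le_sum fun χ _ => ?_).trans (sum_le_sum_of_subset_of_nonneg ?_
    fun _ _ _ => norm_nonneg _)
  · rw [norm_mul, ← norm_charSum]
    exact mul_le_of_le_one_left (norm_nonneg _) (χ.norm_le_one _)
  · intro χ hχ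
    rw [mem_filter] at hχ ⊢
    exact ⟨mem_univ _, not_le.mp fun h => hχ.2 (mem_inducedChars_of_conductor_le χ h)⟩

/-- The restriction of `f` to the integers coprime to `s`. -/
def coprimeTo (s : ℕ) (f : ℕ → ℂ) (n : ℕ) : ℂ := if n.Coprime s then f n else 0

lemma dirichletCharacter_apply_eq {q : ℕ} [NeZero q] (χ : DirichletCharacter ℂ q) (n : ℕ) :
    χ (n : ZMod q) =
      if n.Coprime (q / χ.conductor) then χ.primitiveCharacter (n : ZMod χ.conductor) else 0 := by
  have hd := χ.conductor_dvd_level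
  by_cases h : n.Coprime q
  · rw [if_pos (h.coprime_dvd_right (Nat.div_dvd_of_dvd hd))]
    have := χ.primitiveCharacter_apply_of_isCoprime (a := n)
      (by rw [Nat.isCoprime_iff_coprime]; exact h)
    push_cast at this
    exact this.symm
  · rw [MulChar.map_nonunit χ (by rwa [ZMod.isUnit_iff_coprime])]
    split_ifs with h1
    · rw [MulChar.map_nonunit]
      rw [ZMod.isUnit_iff_coprime]
      intro h2
      apply h
      rw [← Nat.div_mul_cancel hd]
      exact Nat.Coprime.mul_right h1 h2
    · rfl

lemma sigma_changeLevel_eq {q : ℕ} (χ : DirichletCharacter ℂ q) (m : ℕ) (h : χ.conductor ∣ m)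
    (hm : m = q) : (⟨m, DirichletCharacter.changeLevel h χ.primitiveCharacter⟩ : AnyCharacter)
      = ⟨q, χ⟩ := by
  subst hm
  rw [χ.changeLevel_primitiveCharacter]

open Classical in
/-- The reduction to primitive characters. -/
theorem sum_large_conductor_le (T : ℝ) (Q X : ℕ) (f : ℕ → ℂ) :
    ∑ q ∈ Icc 1 Q, (1 / q.totient : ℝ) * ∑ χ : DirichletCharacter ℂ q with T < χ.conductor,
        ‖∑ n ∈ Icc 1 X, f n * χ (n : ZMod q)‖
      ≤ ∑ s ∈ Icc 1 Q, (1 / s.totient : ℝ) *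
          primMoment {r ∈ Icc 1 Q | T < (r : ℝ)} X (coprimeTo s f) := by
  set I : Finset AnyCharacter :=
    (Icc 1 Q).sigma fun q => univ.filter fun χ => T < (χ.conductor : ℝ) with hI
  set K : Finset (Σ _ : ℕ, AnyCharacter) := (Icc 1 Q).sigma fun _ =>
    ((Icc 1 Q).filter fun r : ℕ => T < (r : ℝ)).sigma fun r =>
      univ.filter fun χ : DirichletCharacter ℂ r => χ.IsPrimitive with hK
  set F : AnyCharacter → ℝ := fun i =>
    (1 / i.1.totient : ℝ) * ‖∑ n ∈ Icc 1 X, f n * i.2 (n : ZMod i.1)‖ with hF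
  set G : (Σ _ : ℕ, AnyCharacter) → ℝ := fun k => (1 / k.1.totient : ℝ) *
    ((1 / k.2.1.totient : ℝ) * ‖∑ n ∈ Icc 1 X, coprimeTo k.1 f n * k.2.2 (n : ZMod k.2.1)‖) with hG
  set Φ : AnyCharacter → (Σ _ : ℕ, AnyCharacter) := fun i =>
    ⟨i.1 / i.2.conductor, ⟨i.2.conductor, i.2.primitiveCharacter⟩⟩ with hΦ
  set Ψ : (Σ _ : ℕ, AnyCharacter) → AnyCharacter := fun k =>
    ⟨k.1 * k.2.1, DirichletCharacter.changeLevel (dvd_mul_left _ _) k.2.2⟩ with hΨ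
  have hLHS : ∑ q ∈ Icc 1 Q, (1 / q.totient : ℝ) *
      ∑ χ : DirichletCharacter ℂ q with T < χ.conductor,
        ‖∑ n ∈ Icc 1 X, f n * χ (n : ZMod q)‖ = ∑ i ∈ I, F i := by
    rw [hI, sum_sigma]
    exact sum_congr rfl fun q _ => mul_sum _ _ _
  have hRHS : ∑ s ∈ Icc 1 Q, (1 / s.totient : ℝ) *
      primMoment {r ∈ Icc 1 Q | T < (r : ℝ)} X (coprimeTo s f) = ∑ k ∈ K, G k := by
    rw [hK, sum_sigma]
    refine sum_congr rfl fun s _ => ?_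
    rw [primMoment, sum_sigma, mul_sum]
    refine sum_congr rfl fun r _ => ?_
    rw [mul_sum, mul_sum]
  have hinv : ∀ i ∈ I, Ψ (Φ i) = i := by
    rintro ⟨q, χ⟩ -
    exact sigma_changeLevel_eq χ _ _ (Nat.div_mul_cancel χ.conductor_dvd_level)
  have hinj : Set.InjOn Φ I := fun i hi j hj hij => by
    rw [← hinv i hi, ← hinv j hj, hij]
  have hmaps : I.image Φ ⊆ K := by
    intro k hk
    rw [mem_image] at hk
    obtain ⟨⟨q, χ⟩, hi, rfl⟩ := hk
    simp only [hI, mem_sigma, mem_Icc, mem_filter, mem_univ, true_and] at hi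
    have : NeZero q := ⟨by omega⟩
    have hc := Nat.pos_of_ne_zero χ.conductor_ne_zero
    have hcq := Nat.le_of_dvd (by omega) χ.conductor_dvd_level
    simp only [hK, hΦ, mem_sigma, mem_Icc, mem_filter, mem_univ, true_and]
    exact ⟨⟨Nat.div_pos hcq hc, (Nat.div_le_self _ _).trans hi.1.2⟩,
      ⟨⟨hc, hcq.trans hi.1.2⟩, hi.2⟩, χ.primitiveCharacter_isPrimitive⟩
  rw [hLHS, hRHS]
  calc ∑ i ∈ I, F i ≤ ∑ i ∈ I, G (Φ i) := by
        refine sum_le_sum ?_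
        rintro ⟨q, χ⟩ hi
        simp only [hI, mem_sigma, mem_Icc, mem_filter, mem_univ, true_and] at hi
        have : NeZero q := ⟨by omega⟩
        have hc := Nat.pos_of_ne_zero χ.conductor_ne_zero
        have hcq := Nat.le_of_dvd (by omega) χ.conductor_dvd_level
        have hs := Nat.div_pos hcq hc
        simp only [hF, hG, hΦ]
        have hsum : ∑ n ∈ Icc 1 X, f n * χ (n : ZMod q) = ∑ n ∈ Icc 1 X,
            coprimeTo (q / χ.conductor) f n * χ.primitiveCharacter (n : ZMod χ.conductor) := by
          refine sum_congr rfl fun n _ => ?_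
          rw [dirichletCharacter_apply_eq, coprimeTo]
          split_ifs <;> simp
        rw [hsum, ← mul_assoc]
        refine mul_le_mul_of_nonneg_right ?_ (norm_nonneg _)
        rw [one_div_mul_one_div]
        have h1 : 0 < (q / χ.conductor).totient * χ.conductor.totient :=
          Nat.mul_pos (Nat.totient_pos.mpr hs) (Nat.totient_pos.mpr hc)
        have h2 := Nat.totient_super_multiplicative (q / χ.conductor) χ.conductor
        rw [Nat.div_mul_cancel χ.conductor_dvd_level] at h2
        exact one_div_le_one_div_of_le (by exact_mod_cast h1) (by exact_mod_cast h2)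
    _ = ∑ k ∈ I.image Φ, G k := (sum_image hinj).symm
    _ ≤ ∑ k ∈ K, G k := sum_le_sum_of_subset_of_nonneg hmaps fun _ _ _ => by positivity

lemma log_le_four_mul_rpow {t : ℝ} (ht : 0 ≤ t) : Real.log t ≤ 4 * t ^ (1 / 4 : ℝ) := by
  have := Real.log_le_rpow_div ht (by norm_num : (0 : ℝ) < 1 / 4)
  linarith [this.trans_eq (by ring : t ^ (1 / 4 : ℝ) / (1 / 4) = 4 * t ^ (1 / 4 : ℝ))]

lemma smooth_exponent_le {γ L : ℝ} (hγ : 1 ≤ γ) (hL : 1 ≤ L)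
    (hLγ : 2 * γ * (4 + 20 * γ) ≤ L ^ (1 / 4 : ℝ)) :
    2 * γ * Real.log L ≤ L ∧
      4 * (L ^ (1 / 2 : ℝ) * (1 + γ * Real.log L)) + γ * Real.log L ≤ L / (2 * γ) := by
  set u := L ^ (1 / 4 : ℝ) with hu
  have h2 : L ^ (1 / 2 : ℝ) = u ^ 2 := by
    rw [hu, ← Real.rpow_natCast, ← Real.rpow_mul (by linarith)]; norm_num
  have h4 : L = u ^ 4 := by
    rw [hu, ← Real.rpow_natCast, ← Real.rpow_mul (by linarith)]; norm_num
  have hlog : Real.log L ≤ 4 * u := log_le_four_mul_rpow (by linarith)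
  have hu1 : 1 ≤ u := by nlinarith
  have hu8 : 8 * γ ≤ u := by nlinarith
  have hu2 : 1 ≤ u ^ 2 := one_le_pow₀ hu1
  have hγlog : γ * Real.log L ≤ 4 * γ * u := by nlinarith
  constructor
  · calc 2 * γ * Real.log L ≤ 8 * γ * u := by nlinarith
      _ ≤ u * u := by gcongr
      _ ≤ u ^ 4 := by nlinarith
      _ = L := h4.symm
  · rw [le_div_iff₀ (by linarith), h2]
    calc (4 * (u ^ 2 * (1 + γ * Real.log L)) + γ * Real.log L) * (2 * γ)
        ≤ (4 * (u ^ 2 * (1 + 4 * γ * u)) + 4 * γ * u) * (2 * γ) := by gcongr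
      _ ≤ (2 * γ * (4 + 20 * γ)) * u ^ 3 := by
          have h3 : u ^ 2 ≤ u ^ 3 := pow_le_pow_right₀ hu1 (by norm_num)
          have h3' : u ≤ u ^ 3 := le_self_pow₀ hu1 (by norm_num)
          have : 4 * (u ^ 2 * (1 + 4 * γ * u)) + 4 * γ * u ≤ (4 + 20 * γ) * u ^ 3 := by
            nlinarith
          nlinarith
      _ ≤ u * u ^ 3 := by gcongr
      _ = L := by rw [h4]; ring

open Classical in
lemma card_log_smooth_le {γ x : ℝ} (hγ : 1 ≤ γ) (hL : 1 ≤ Real.log x)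
    (hLγ : 2 * γ * (4 + 20 * γ) ≤ (Real.log x) ^ (1 / 4 : ℝ)) (hx : 0 < x) :
    (#{n ∈ Icc 1 ⌊x⌋₊ | IsSmooth ((Real.log x) ^ γ) n} : ℝ) ≤ x / (Real.log x) ^ γ := by
  set L := Real.log x with hLdef
  have hL0 : 0 < L := by linarith
  have hD : 1 ≤ L ^ γ := Real.one_le_rpow hL (by linarith)
  set σ := 1 - 1 / (2 * γ) with hσ
  have h1γ : 1 / (2 * γ) ≤ 1 / 2 := by
    rw [div_le_div_iff₀ (by linarith) two_pos]; linarith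
  have h0γ : 0 < 1 / (2 * γ) := by positivity
  refine (card_smooth_le (σ := σ) (by linarith) (by linarith) hD _).trans ?_
  have hpow : (L ^ γ) ^ (1 - σ) = L ^ (1 / 2 : ℝ) := by
    rw [← Real.rpow_mul hL0.le, hσ]
    congr 1
    field_simp
    ring
  rw [hpow, Real.log_rpow hL0]
  have hexp := (smooth_exponent_le hγ hL hLγ).2
  have hxσ : (⌊x⌋₊ : ℝ) ^ σ ≤ x * Real.exp (-(L / (2 * γ))) := by
    calc (⌊x⌋₊ : ℝ) ^ σ ≤ x ^ σ :=
          Real.rpow_le_rpow (by positivity) (Nat.floor_le hx.le) (by linarith)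
      _ = x * Real.exp (-(L / (2 * γ))) := by
          rw [Real.rpow_def_of_pos hx]
          conv_rhs => rw [← Real.exp_log hx, ← Real.exp_add]
          rw [hσ, ← hLdef]
          congr 1
          ring
  have hLγ' : L ^ γ = Real.exp (γ * Real.log L) := by
    rw [Real.rpow_def_of_pos hL0, mul_comm]
  rw [hLγ', div_eq_mul_inv x, ← Real.exp_neg]
  calc _ ≤ x * Real.exp (-(L / (2 * γ))) *
        Real.exp (4 * (L ^ (1 / 2 : ℝ) * (1 + γ * Real.log L))) := by gcongr
    _ = x * Real.exp (-(L / (2 * γ)) + 4 * (L ^ (1 / 2 : ℝ) * (1 + γ * Real.log L))) := by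
        rw [Real.exp_add]; ring
    _ ≤ _ := by
        gcongr
        linarith

open Classical in
lemma primMoment_le_sum_dyadic (T : ℝ) {Q : ℕ} (X : ℕ) (c : ℕ → ℂ) :
    primMoment {r ∈ Icc 1 Q | T < (r : ℝ)} X c ≤
      ∑ i ∈ range (Nat.log 2 Q + 1) with T < 2 * (2 : ℝ) ^ i,
        primMoment (Ico (2 ^ i) (2 * 2 ^ i)) X c := by
  simp only [primMoment]
  set F : ℕ → ℝ := fun r => (1 / r.totient : ℝ) *
    ∑ χ : DirichletCharacter ℂ r with χ.IsPrimitive, ‖∑ n ∈ Icc 1 X, c n * χ (n : ZMod r)‖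
  have hF : ∀ r, 0 ≤ F r := fun r => by positivity
  have hmaps : ∀ r ∈ ({r ∈ Icc 1 Q | T < (r : ℝ)} : Finset ℕ),
      Nat.log 2 r ∈ ({i ∈ range (Nat.log 2 Q + 1) | T < 2 * (2 : ℝ) ^ i} : Finset ℕ) := by
    intro r hr
    rw [mem_filter, mem_Icc] at hr
    rw [mem_filter, mem_range]
    refine ⟨Nat.lt_succ_of_le (Nat.log_mono_right hr.1.2), hr.2.trans_le ?_⟩
    have : r ≤ 2 ^ (Nat.log 2 r + 1) := (Nat.lt_pow_succ_log_self one_lt_two r).le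
    have h2 : (r : ℝ) ≤ ((2 ^ (Nat.log 2 r + 1) : ℕ) : ℝ) := by exact_mod_cast this
    push_cast at h2
    rwa [pow_succ'] at h2
  rw [← sum_fiberwise_of_maps_to hmaps]
  refine sum_le_sum fun i _ => sum_le_sum_of_subset_of_nonneg ?_ fun r _ _ => hF r
  intro r hr
  rw [mem_filter, mem_filter, mem_Icc] at hr
  rw [mem_Ico, ← pow_succ', ← hr.2]
  exact ⟨Nat.pow_log_le_self 2 (by omega), Nat.lt_pow_succ_log_self one_lt_two r⟩

lemma coprimeTo_norm_le {f : ℕ → ℂ} (hf : ∀ n, ‖f n‖ ≤ 1) (s n : ℕ) : ‖coprimeTo s f n‖ ≤ 1 := by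
  rw [coprimeTo]
  split_ifs
  · exact hf n
  · simp

lemma coprimeTo_mul {f : ℕ → ℂ} (hf : ∀ p m : ℕ, p.Prime → ¬ p ∣ m → f (p * m) = f p * f m)
    (s p m : ℕ) (hp : p.Prime) (hpm : ¬ p ∣ m) :
    coprimeTo s f (p * m) = coprimeTo s f p * coprimeTo s f m := by
  simp only [coprimeTo, Nat.coprime_mul_iff_left]
  split_ifs <;> simp_all

lemma coprimeTo_ne_zero {f : ℕ → ℂ} {s n : ℕ} (h : coprimeTo s f n ≠ 0) : f n ≠ 0 := by
  rw [coprimeTo] at h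
  split_ifs at h with h1
  · exact h
  · exact absurd rfl h

/-- The estimate for one dyadic range of moduli, with all parameters in terms of `x`. -/
theorem exists_primMoment_dyadic_le (A B γ : ℝ) (hA : 0 ≤ A) (hB : A + 5 < B)
    (hγ : 2 * A + 6 < γ) : ∃ C : ℝ, 0 < C ∧ ∀ (x : ℝ) (R : ℕ) (f : ℕ → ℂ), 1 ≤ Real.log x →
    2 * γ * (4 + 20 * γ) ≤ (Real.log x) ^ (1 / 4 : ℝ) → 0 < x → 1 ≤ R →
    (Real.log x) ^ B < 2 * R → (R : ℝ) ≤ √x / (Real.log x) ^ B →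
    (∀ n, ‖f n‖ ≤ 1) → (∀ p m : ℕ, p.Prime → ¬ p ∣ m → f (p * m) = f p * f m) →
    (∀ n, f n ≠ 0 → IsSmooth (x / (Real.log x) ^ γ) n) →
    primMoment (Ico R (2 * R)) ⌊x⌋₊ f ≤ C * (x * (Real.log x) ^ (-A - 2)) := by
  classical
  obtain ⟨C, hC, hmain⟩ := exists_primMoment_le
  refine ⟨57 * C, by positivity, fun x R f hL hLγ hx hR hTR hRQ hf hmul hsupp => ?_⟩
  set L := Real.log x with hLdef
  have hL0 : 0 < L := by linarith
  have hγ1 : 1 ≤ γ := by linarith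
  have hx1 : 1 ≤ x := by
    rw [← Real.exp_log hx, ← hLdef]; exact Real.one_le_exp hL0.le
  set X := ⌊x⌋₊ with hX
  have hX1 : 1 ≤ X := Nat.floor_pos.mpr hx1
  have hXx : (X : ℝ) ≤ x := Nat.floor_le hx.le
  have hX0 : (0 : ℝ) < X := by exact_mod_cast hX1
  have hlogX : Real.log X ≤ L := Real.log_le_log hX0 hXx
  have hlogX0 : 0 ≤ Real.log X := Real.log_natCast_nonneg X
  have hR0 : (0 : ℝ) < R := by exact_mod_cast hR
  set D := L ^ γ with hD
  have hD1 : 1 ≤ D := Real.one_le_rpow hL (by linarith)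
  have hD0 : 0 < D := by linarith
  have hDy : D ≤ x / D := by
    rw [le_div_iff₀ hD0, hD, ← Real.rpow_add hL0, Real.rpow_def_of_pos hL0, ← Real.exp_log hx]
    refine Real.exp_le_exp.mpr ?_
    have := (smooth_exponent_le hγ1 hL hLγ).1
    rw [← hLdef]; linarith
  have hyx : x / D ≤ x := div_le_self hx.le hD1
  have hlogy : Real.log (x / D) ≤ L := Real.log_le_log (by positivity) hyx
  have hlogy0 : 0 ≤ Real.log (x / D) := Real.log_nonneg (hD1.trans hDy)
  have hsx := Real.mul_self_sqrt hx.le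
  have hsX : √(X : ℝ) ≤ √x := Real.sqrt_le_sqrt hXx
  have hLB0 : 0 < L ^ B := by positivity
  have hLB : 1 ≤ L ^ B := Real.one_le_rpow hL (by linarith)
  have hsD : √D = L ^ (γ / 2) := by
    rw [Real.sqrt_eq_rpow, hD, ← Real.rpow_mul hL0.le]; ring_nf
  have hRx : (R : ℝ) ^ 2 ≤ x := by
    have h1 : (R : ℝ) ≤ √x := hRQ.trans (div_le_self (Real.sqrt_nonneg x) hLB)
    nlinarith
  have e1 : (X / R + R * √X : ℝ) ≤ 3 * (x * L ^ (-B)) := by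
    have h1 : (X / R : ℝ) ≤ 2 * (x * L ^ (-B)) := by
      rw [Real.rpow_neg hL0.le, ← div_eq_mul_inv, mul_div_assoc', div_le_div_iff₀ hR0 hLB0]
      nlinarith
    have h2 : (R * √X : ℝ) ≤ x * L ^ (-B) := by
      calc (R * √X : ℝ) ≤ (√x / L ^ B) * √x := by gcongr
        _ = (√x * √x) * L ^ (-B) := by rw [Real.rpow_neg hL0.le]; ring
        _ = _ := by rw [hsx]
    linarith
  have e2 : √(X : ℝ) * √(x / D) ≤ x * L ^ (-(γ / 2)) := by
    rw [Real.sqrt_div hx.le, hsD, Real.rpow_neg hL0.le, ← div_eq_mul_inv, mul_div_assoc']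
    gcongr
    calc √(X : ℝ) * √x ≤ √x * √x := by gcongr
      _ = x := hsx
  have e3 : (X / √D : ℝ) ≤ x * L ^ (-(γ / 2)) := by
    rw [hsD, Real.rpow_neg hL0.le, ← div_eq_mul_inv]
    gcongr
  have e4 : √((X + (R : ℝ) ^ 2) * (#{n ∈ Icc 1 X | IsSmooth D n} + X / D))
      ≤ 2 * (x * L ^ (-(γ / 2))) := by
    refine Real.sqrt_le_iff.mpr ⟨by positivity, ?_⟩
    have hs := card_log_smooth_le hγ1 hL hLγ hx
    rw [← hLdef, ← hD, ← hX] at hs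
    have hsq : (L ^ (-(γ / 2))) ^ 2 = D⁻¹ := by
      rw [← Real.rpow_natCast, ← Real.rpow_mul hL0.le, hD, ← Real.rpow_neg hL0.le]
      congr 1
      push_cast; ring
    calc (X + (R : ℝ) ^ 2) * (#{n ∈ Icc 1 X | IsSmooth D n} + X / D)
        ≤ (x + x) * (x / D + x / D) := by gcongr
      _ = (2 * (x * L ^ (-(γ / 2)))) ^ 2 := by rw [mul_pow, mul_pow, hsq]; ring
  have p1 : L * (L * L ^ (-B)) ≤ L ^ (-A - 2) := by
    rw [← Real.rpow_one_add' hL0.le (by linarith), ← Real.rpow_one_add' hL0.le (by linarith)]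
    exact Real.rpow_le_rpow_of_exponent_le hL (by linarith)
  have p2 : L * L ^ (-(γ / 2)) ≤ L ^ (-A - 2) := by
    rw [← Real.rpow_one_add' hL0.le (by linarith)]
    exact Real.rpow_le_rpow_of_exponent_le hL (by linarith)
  have p3 : L ^ (-(γ / 2)) ≤ L ^ (-A - 2) :=
    Real.rpow_le_rpow_of_exponent_le hL (by linarith)
  refine (hmain R X D (x / D) f hR hX1 hD1 hDy hf hmul hsupp).trans ?_
  calc _ ≤ C * (5 * L) * ((3 * L) * (3 * (x * L ^ (-B))) + x * L ^ (-(γ / 2))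
          + x * L ^ (-(γ / 2))) + C * (2 * (x * L ^ (-(γ / 2)))) := by
        gcongr
        · linarith
        · linarith
    _ = C * (x * (45 * (L * (L * L ^ (-B))) + 10 * (L * L ^ (-(γ / 2)))
          + 2 * L ^ (-(γ / 2)))) := by ring
    _ ≤ C * (x * (45 * L ^ (-A - 2) + 10 * L ^ (-A - 2) + 2 * L ^ (-A - 2))) := by gcongr
    _ = _ := by ring

/-- The estimate for the contribution of the characters of large conductor. -/
theorem exists_sum_large_conductor_le (A B γ : ℝ) (hA : 0 ≤ A) (hB : A + 5 < B)
    (hγ : 2 * A + 6 < γ) : ∃ C : ℝ, 0 < C ∧ ∀ (x : ℝ) (f : ℕ → ℂ), 1 ≤ Real.log x →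
    2 * γ * (4 + 20 * γ) ≤ (Real.log x) ^ (1 / 4 : ℝ) → 0 < x →
    (∀ n, ‖f n‖ ≤ 1) → (∀ p m : ℕ, p.Prime → ¬ p ∣ m → f (p * m) = f p * f m) →
    (∀ n, f n ≠ 0 → IsSmooth (x / (Real.log x) ^ γ) n) →
    open Classical in
    ∑ q ∈ Icc 1 ⌊√x / (Real.log x) ^ B⌋₊, (1 / q.totient : ℝ) *
      ∑ χ : DirichletCharacter ℂ q with (Real.log x) ^ B < χ.conductor,
        ‖∑ n ∈ Icc 1 ⌊x⌋₊, f n * χ (n : ZMod q)‖ ≤ C * (x / (Real.log x) ^ A) := by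
  classical
  obtain ⟨C, hC, hdy⟩ := exists_primMoment_dyadic_le A B γ hA hB hγ
  refine ⟨24 * C, by positivity, fun x f hL hLγ hx hf hmul hsupp => ?_⟩
  set L := Real.log x with hLdef
  have hL0 : 0 < L := by linarith
  have hx1 : 1 ≤ x := by
    rw [← Real.exp_log hx, ← hLdef]; exact Real.one_le_exp hL0.le
  have hLB : 1 ≤ L ^ B := Real.one_le_rpow hL (by linarith)
  set Q := ⌊√x / L ^ B⌋₊ with hQ
  rcases Nat.eq_zero_or_pos Q with hQ0 | hQ1
  · rw [hQ0, Icc_eq_empty_of_lt zero_lt_one, sum_empty]; positivity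
  have hQle : (Q : ℝ) ≤ √x / L ^ B := Nat.floor_le (by positivity)
  have hQx : (Q : ℝ) ≤ x := by
    refine (hQle.trans (div_le_self (Real.sqrt_nonneg x) hLB)).trans ?_
    rw [Real.sqrt_le_left (by linarith)]
    nlinarith
  have hQ0 : (0 : ℝ) < Q := by exact_mod_cast hQ1
  have hlogQ : Real.log Q ≤ L := Real.log_le_log hQ0 hQx
  have hmom : ∀ s ∈ Icc 1 Q, primMoment {r ∈ Icc 1 Q | L ^ B < (r : ℝ)} ⌊x⌋₊ (coprimeTo s f)
      ≤ 3 * L * (C * (x * L ^ (-A - 2))) := by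
    intro s _
    refine (primMoment_le_sum_dyadic (L ^ B) _ _).trans ?_
    have hterm : ∀ i ∈ ({i ∈ range (Nat.log 2 Q + 1) | L ^ B < 2 * (2 : ℝ) ^ i} : Finset ℕ),
        primMoment (Ico (2 ^ i) (2 * 2 ^ i)) ⌊x⌋₊ (coprimeTo s f)
          ≤ C * (x * L ^ (-A - 2)) := by
      intro i hi
      rw [mem_filter, mem_range] at hi
      have h2i : 2 ^ i ≤ Q := (Nat.pow_le_pow_right two_pos (Nat.le_of_lt_succ hi.1)).trans
        (Nat.pow_log_le_self 2 hQ1.ne')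
      have h2i' : ((2 ^ i : ℕ) : ℝ) ≤ Q := by exact_mod_cast h2i
      exact hdy x (2 ^ i) (coprimeTo s f) hL hLγ hx Nat.one_le_two_pow
        (by push_cast; exact hi.2) (h2i'.trans hQle) (coprimeTo_norm_le hf s)
        (coprimeTo_mul hmul s) (fun n hn => hsupp n (coprimeTo_ne_zero hn))
    refine (sum_le_card_nsmul _ _ _ hterm).trans ?_
    rw [nsmul_eq_mul]
    refine mul_le_mul_of_nonneg_right ?_ (by positivity)
    have h1 : (#{i ∈ range (Nat.log 2 Q + 1) | L ^ B < 2 * (2 : ℝ) ^ i} : ℝ)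
        ≤ (Nat.log 2 Q + 1 : ℕ) := by
      exact_mod_cast (card_filter_le _ _).trans_eq (card_range _)
    have h2 := nat_log_two_le hQ1
    push_cast at h1
    linarith
  refine (sum_large_conductor_le (L ^ B) Q ⌊x⌋₊ f).trans ?_
  calc _ ≤ ∑ s ∈ Icc 1 Q, (1 / s.totient : ℝ) * (3 * L * (C * (x * L ^ (-A - 2)))) :=
        sum_le_sum fun s hs => mul_le_mul_of_nonneg_left (hmom s hs) (by positivity)
    _ = (∑ s ∈ Icc 1 Q, (1 / s.totient : ℝ)) * (3 * L * (C * (x * L ^ (-A - 2)))) := by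
        rw [sum_mul]
    _ ≤ (8 * L) * (3 * L * (C * (x * L ^ (-A - 2)))) := by
        gcongr
        exact (sum_one_div_totient_le Q).trans (by linarith)
    _ = 24 * C * (x * (L * (L * L ^ (-A - 2)))) := by ring
    _ = _ := by
        congr 2
        rw [Real.rpow_sub hL0, Real.rpow_neg hL0.le, Real.rpow_two]
        field_simp

lemma norm_Delta_le_self {f : ArithmeticFunction ℂ} (hf : ∀ n, ‖f n‖ ≤ 1) {x : ℝ} (hx : 0 ≤ x)
    (T : ℝ) {q : ℕ} [NeZero q] (a : (ZMod q)ˣ) : ‖Delta (primitiveUpTo T) f x q a‖ ≤ x := by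
  classical
  refine (norm_Delta_le f x T a).trans ?_
  have hφ : (0 : ℝ) < q.totient := by
    exact_mod_cast Nat.totient_pos.mpr (Nat.pos_of_ne_zero (NeZero.ne q))
  have hterm : ∀ χ : DirichletCharacter ℂ q,
      ‖∑ n ∈ Icc 1 ⌊x⌋₊, (starRingEnd ℂ) (f n) * χ (n : ZMod q)‖ ≤ x := by
    intro χ
    calc _ ≤ ∑ n ∈ Icc 1 ⌊x⌋₊, (1 : ℝ) := by
          refine (norm_sum_le _ _).trans (sum_le_sum fun n _ => ?_)
          rw [norm_mul, RCLike.norm_conj]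
          exact mul_le_one₀ (hf n) (norm_nonneg _) (χ.norm_le_one _)
      _ = ⌊x⌋₊ := by simp
      _ ≤ x := Nat.floor_le hx
  rw [one_div_mul_eq_div, div_le_iff₀ hφ]
  calc _ ≤ ∑ χ : DirichletCharacter ℂ q,
        ‖∑ n ∈ Icc 1 ⌊x⌋₊, (starRingEnd ℂ) (f n) * χ (n : ZMod q)‖ :=
        sum_le_sum_of_subset_of_nonneg (filter_subset _ _) fun _ _ _ => norm_nonneg _
    _ ≤ ∑ _χ : DirichletCharacter ℂ q, x := sum_le_sum fun χ _ => hterm χ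
    _ = x * q.totient := by
        rw [sum_const, card_univ, nsmul_eq_mul, ← Nat.card_eq_fintype_card,
          DirichletCharacter.card_eq_totient_of_hasEnoughRootsOfUnity ℂ q, mul_comm]

end BVMult

end

theorem theorem2p2 (A B γ : ℝ) (hA : 0 ≤ A) (hB : A + 5 < B) (hγ : 2 * A + 6 < γ) :
    ∃ C : ℝ, ∀ x : ℝ, 2 ≤ x → ∀ f : ArithmeticFunction ℂ, BVMult.ClassC f →
      BVMult.SmoothSupported f (x / (Real.log x) ^ γ) →
      ∑ q ∈ Finset.Icc 1 ⌊x ^ (1 / 2 : ℝ) / (Real.log x) ^ B⌋₊,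
          ⨆ a : (ZMod q)ˣ,
            ‖BVMult.Delta (BVMult.primitiveUpTo ((Real.log x) ^ B)) f x q (a : ZMod q)‖
        ≤ C * (x / (Real.log x) ^ A) := by
  classical
  obtain ⟨C, hC, hlarge⟩ := BVMult.exists_sum_large_conductor_le A B γ hA hB hγ
  have hev : ∀ᶠ x : ℝ in Filter.atTop,
      1 ≤ Real.log x ∧ 2 * γ * (4 + 20 * γ) ≤ (Real.log x) ^ (1 / 4 : ℝ) :=
    (Real.tendsto_log_atTop.eventually_ge_atTop 1).and
      (((tendsto_rpow_atTop (by norm_num : (0 : ℝ) < 1 / 4)).comp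
        Real.tendsto_log_atTop).eventually_ge_atTop _)
  obtain ⟨x₀, hx₀⟩ := Filter.eventually_atTop.mp hev
  refine ⟨max C (√x₀ * (Real.log 2) ^ (A - B)), fun x hx f hf hsupp => ?_⟩
  have hbd := hf.norm_le_one
  have hx0 : 0 < x := by linarith
  have hlog2 : 0 < Real.log 2 := Real.log_pos one_lt_two
  have hlogle : Real.log 2 ≤ Real.log x := Real.log_le_log two_pos hx
  have hL0 : 0 < Real.log x := hlog2.trans_le hlogle
  rw [← Real.sqrt_eq_rpow]
  rcases le_or_gt x₀ x with hxx | hxx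
  · obtain ⟨hL, hLγ⟩ := hx₀ x hxx
    refine le_trans ?_ (mul_le_mul_of_nonneg_right (le_max_left _ _) (by positivity))
    refine le_trans (Finset.sum_le_sum fun q hq => ?_)
      (hlarge x (fun n => (starRingEnd ℂ) (f n)) hL hLγ hx0 (fun n => ?_) (fun p m hp hpm => ?_)
        (fun n hn => ?_))
    · have : NeZero q := ⟨by rw [Finset.mem_Icc] at hq; omega⟩
      exact ciSup_le fun a => BVMult.norm_Delta_le f x _ a
    · rw [RCLike.norm_conj]; exact hbd n
    · obtain ⟨hmul, -⟩ := hf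
      rw [← map_mul, hmul.map_mul_of_coprime ((Nat.Prime.coprime_iff_not_dvd hp).mpr hpm)]
    · exact hsupp n fun h => hn (by rw [h, map_zero])
  · refine le_trans ?_ (mul_le_mul_of_nonneg_right (le_max_right _ _) (by positivity))
    have hterm : ∀ q ∈ Finset.Icc 1 ⌊√x / (Real.log x) ^ B⌋₊, ⨆ a : (ZMod q)ˣ,
        ‖BVMult.Delta (BVMult.primitiveUpTo ((Real.log x) ^ B)) f x q (a : ZMod q)‖ ≤ x := by
      intro q hq
      have : NeZero q := ⟨by rw [Finset.mem_Icc] at hq; omega⟩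
      exact ciSup_le fun a => BVMult.norm_Delta_le_self hbd hx0.le _ a
    refine (Finset.sum_le_card_nsmul _ _ _ hterm).trans ?_
    rw [Nat.card_Icc, Nat.add_sub_cancel, nsmul_eq_mul]
    calc (⌊√x / (Real.log x) ^ B⌋₊ : ℝ) * x ≤ √x / (Real.log x) ^ B * x := by
          gcongr
          exact Nat.floor_le (by positivity)
      _ = √x * (Real.log x) ^ (A - B) * (x / (Real.log x) ^ A) := by
          rw [Real.rpow_sub hL0]; field_simp
      _ ≤ √x₀ * (Real.log 2) ^ (A - B) * (x / (Real.log x) ^ A) := by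
          gcongr ?_ * ?_ * _
          · exact Real.sqrt_le_sqrt hxx.le
          · exact Real.rpow_le_rpow_of_nonpos hlog2 hlogle (by linarith)
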